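/- Let $d\ge 0$ be an integer and $[m]=\{1,\dots,m\}$. **Partition labeled trees.** An ordered partition of $[d+1]$ is a tuple $\mathcal S=(S_1,\dots,S_k)$ of pairwise disjoint nonempty sets with union $[d+1]$. A plane rooted tree (the subtrees at each vertex are linearly ordered) is strictly branching if each internal (i.e. non-leaf) vertex has at least two children; trees are considered up to isomorphism. $\mathscr P_d$ is the set of pairs $(\mathcal S,\mathrm T)$ where $\mathcal S=(S_1,\dots,S_k)$ is an ordered partition of $[d+1]$ and $\mathrm T$ is a strictly branching plane rooted tree with $k$ leaves $\ell_1,\dots,\ell_k$ (from left to right); $S_a$ is regarded as the label of $\ell_a$. **Kapranov poset.** Write $(\mathcal S_1,\mathrm T_1)\lessdot_{KP}(\mathcal S_2,\mathrm T_2)$ if either (i) $\mathcal S_1=\mathcal S_2$ and $\mathrm T_2$ is obtained from $\mathrm T_1$ by contracting a single edge between two internal vertices; or (ii) $\mathrm T_1$ has an internal vertex $p$ all of whose children are leaves, $\mathrm T_2$ is obtained from $\mathrm T_1$ by contracting all edges between $p$ and its children, and $\mathcal S_2$ is obtained from $\mathcal S_1$ by labeling the resulting new leaf with the union of the labels of the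 children of $p$ and keeping all other labels. Let $\le_{KP}$ be the reflexive-transitive closure of $\lessdot_{KP}$ on $\mathscr P_d$; it is a partial order, and the Kapranov poset is $\mathscr P_d$ with this order and an added minimum $\hat 0$. **Cones.** Let $W_d=\mathbb R^{d+1}/\mathbb R(1,\dots,1)$. For a permutation $\pi$ of $[d+1]$ and $1\le i\le d$ put $\mathrm D^\pi_i w=w_{\pi^{-1}(i+1)}-w_{\pi^{-1}(i)}$ for $w\in W_d$. Let $(\mathcal S,\mathrm T)\in\mathscr P_d$, $\mathcal S=(S_1,\dots,S_k)$, $t_i=|S_1|+\dots+|S_i|$. For $1\le i\le k-1$, let $v_i$ be the closest common ancestor of $\ell_i$ and $\ell_{i+1}$ in $\mathrm T$. Define a preorder on $\{t_1,\dots,t_{k-1}\}$ by: $t_i\preceq_{(\mathcal S,\mathrm T)}t_j$ if and only if $v_j=v_i$ or $v_j$ is an ancestor of $v_i$. Choose $\pi$ such that $(\{\pi^{-1}(1)\},\dots,\{\pi^{-1}(d+1)\})$ refines $\mathcal S$, i.e. such that the index of the block of $\mathcal S$ containing $\pi^{-1}(a)$ is weakly increasing in $a$, and let $\sigma(\mathcal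 S,\mathrm T)$ be the set of all $w\in W_d$ such that - $w_x=w_y$ whenever $x,y$ lie in the same block of $\mathcal S$, - $\mathrm D^\pi_i w\le \mathrm D^\pi_j w$ whenever $i\preceq_{(\mathcal S,\mathrm T)}j$, - $\mathrm D^\pi_\ell w\ge 0$ whenever $\ell$ is a minimal element of $\preceq_{(\mathcal S,\mathrm T)}$; this does not depend on the choice of $\pi$. Let $\Xi_d=\{\sigma(\mathcal S,\mathrm T):(\mathcal S,\mathrm T)\in\mathscr P_d\}$. A face of a polyhedron $P\subseteq W_d$ is the empty set or a set of the form $\{x\in P: f(x)\ge f(y)\text{ for all }y\in P\}$ for a linear functional $f$ on $W_d$. **Proposition.** The map $(\mathcal S,\mathrm T)\mapsto\sigma(\mathcal S,\mathrm T)$ is a bijection from $\mathscr P_d$ onto $\Xi_d$. Moreover, for all $(\mathcal S_1,\mathrm T_1),(\mathcal S_2,\mathrm T_2)\in\mathscr P_d$, we have $(\mathcal S_1,\mathrm T_1)\le_{KP}(\mathcal S_2,\mathrm T_2)$ in the Kapranov poset if and only if $\sigma(\mathcal S_2,\mathrm T_2)$ is a face of $\sigma(\mathcal S_1,\mathrm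 T_1)$. -/

import Mathlib

namespace PermutoAssoc

/-! ### Plane rooted trees -/

/-- Unlabeled plane rooted trees: a vertex with the linearly ordered list of the subtrees rooted
at its children. -/
inductive PlaneTree : Type
  | node : List PlaneTree → PlaneTree

namespace PlaneTree

/-- The tree on one vertex. A vertex without children is a leaf; all other vertices are internal. -/
def leaf : PlaneTree := node []

/-- Every internal vertex has at least two children. -/
inductive StrictlyBranching : PlaneTree → Prop
  | leaf : StrictlyBranching leaf
  | node (cs : List PlaneTree) (two_le : 2 ≤ cs.length)
      (children : ∀ c ∈ cs, StrictlyBranching c) : StrictlyBranching (node cs)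

/-! A vertex of a tree is addressed by the path from the root to it: the list of the (zero-based)
positions, among its siblings, of each vertex that follows the root on this path. In particular
`u` is an ancestor of `v` (or `u = v`) if and only if `u` is a prefix of `v`. -/

mutual
/-- The addresses of the leaves of a tree, from left to right. -/
def leafPaths : PlaneTree → List (List ℕ)
  | node [] => [[]]
  | node (c :: cs) => forestLeafPaths 0 (c :: cs)
/-- The addresses of the leaves of a list of sibling trees, the first of which is at position
`p` among its siblings. -/
def forestLeafPaths : ℕ → List PlaneTree → List (List ℕ)
  | _, [] => []
  | p, t :: ts => (leafPaths t).map (fun v => p :: v) ++ forestLeafPaths (p + 1) ts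
end

/-- The number of leaves. -/
def numLeaves (T : PlaneTree) : ℕ := T.leafPaths.length

mutual
/-- The number of internal vertices. -/
def numInternal : PlaneTree → ℕ
  | node [] => 0
  | node (c :: cs) => 1 + forestNumInternal (c :: cs)
/-- The number of internal vertices of a list of trees. -/
def forestNumInternal : List PlaneTree → ℕ
  | [] => 0
  | t :: ts => numInternal t + forestNumInternal ts
end

/-- The closest common ancestor of two vertices: the longest common prefix of the addresses. -/
def commonAncestor : List ℕ → List ℕ → List ℕ
  | a :: u, b :: v => if a = b then a :: commonAncestor u v else []
  | _, _ => []

/-- The `i`-th leaf `ℓ_i` from the left, `1 ≤ i ≤ numLeaves`. -/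
def leafAt (T : PlaneTree) (i : ℕ) : List ℕ := T.leafPaths.getD (i - 1) []

/-- The internal vertex that carries the label `i`, for `1 ≤ i < numLeaves`: the closest common
ancestor of the leaves `ℓ_i` and `ℓ_{i+1}`. -/
def labeledVertex (T : PlaneTree) (i : ℕ) : List ℕ :=
  commonAncestor (T.leafAt i) (T.leafAt (i + 1))

/-- `ContractEdge T T'`: the tree `T'` is obtained from `T` by contracting a single internal edge.
The children of the lower end of the edge take its place in the list of children of
the upper end. -/
inductive ContractEdge : PlaneTree → PlaneTree → Prop
  | root (l r cs : List PlaneTree) (internal : cs ≠ []) :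
      ContractEdge (node (l ++ node cs :: r)) (node (l ++ cs ++ r))
  | child (l r : List PlaneTree) {t t' : PlaneTree} (h : ContractEdge t t') :
      ContractEdge (node (l ++ t :: r)) (node (l ++ t' :: r))

/-- `CollapseVertex T a m T'`: the tree `T` has an internal vertex all of whose children are leaves;
these are the `m` leaves `ℓ_{a+1}, …, ℓ_{a+m}` of `T`; and `T'` is obtained from `T` by
contracting all the edges between this vertex and its children, so that it becomes a leaf. -/
inductive CollapseVertex : PlaneTree → ℕ → ℕ → PlaneTree → Prop
  | root (m : ℕ) (internal : m ≠ 0) : CollapseVertex (node (List.replicate m leaf)) 0 m leaf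
  | child (l r : List PlaneTree) {t t' : PlaneTree} {a m : ℕ} (h : CollapseVertex t a m t') :
      CollapseVertex (node (l ++ t :: r)) ((l.map numLeaves).sum + a) m (node (l ++ t' :: r))

theorem forestNumInternal_append (l r : List PlaneTree) :
    forestNumInternal (l ++ r) = forestNumInternal l + forestNumInternal r := by
  induction l with
  | nil => simp [forestNumInternal]
  | cons t l ih => simp [forestNumInternal, ih, add_assoc]

theorem numInternal_node {l : List PlaneTree} (h : l ≠ []) :
    numInternal (node l) = 1 + forestNumInternal l := by
  cases l with
  | nil => exact absurd rfl h
  | cons c cs => simp [numInternal]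

theorem ContractEdge.numInternal_lt {T T' : PlaneTree} (h : ContractEdge T T') :
    T'.numInternal < T.numInternal := by
  induction h with
  | root l r cs hcs =>
    have h' : l ++ cs ++ r ≠ [] := by simp [hcs]
    rw [numInternal_node h', numInternal_node (by simp)]
    simp only [forestNumInternal_append, forestNumInternal, numInternal_node hcs]
    omega
  | child l r h ih =>
    rw [numInternal_node (by simp), numInternal_node (by simp)]
    simp only [forestNumInternal_append, forestNumInternal]
    omega

theorem CollapseVertex.numInternal_lt {T T' : PlaneTree} {a m : ℕ} (h : CollapseVertex T a m T') :
    T'.numInternal < T.numInternal := by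
  induction h with
  | root m hm =>
    rw [numInternal_node (by simpa using hm)]
    simp [leaf, numInternal]
  | child l r h ih =>
    rw [numInternal_node (by simp), numInternal_node (by simp)]
    simp only [forestNumInternal_append, forestNumInternal]
    omega

end PlaneTree

/-! ### Ordered set partitions -/

/-- Ordered set partitions of an `n`-element set: a list of disjoint nonempty blocks whose union is
the whole set. -/
structure OrderedPartition (n : ℕ) where
  blocks : List (Finset (Fin n))
  nonempty : ∀ B ∈ blocks, B.Nonempty
  disjoint : blocks.Pairwise Disjoint
  cover : ∀ x, ∃ B ∈ blocks, x ∈ B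

namespace OrderedPartition

variable {n : ℕ}

/-- The preorder of an ordered partition: `x ∈ S_a` and `y ∈ S_b` with `a ≤ b`. -/
def Le (S : OrderedPartition n) (x y : Fin n) : Prop :=
  ∃ a b : Fin S.blocks.length, a ≤ b ∧ x ∈ S.blocks.get a ∧ y ∈ S.blocks.get b

/-- The equivalence relation of the preorder: `x` and `y` are in the same block. -/
def Equiv (S : OrderedPartition n) (x y : Fin n) : Prop := S.Le x y ∧ S.Le y x

/-- `S` refines `S'`: each block of `S` lies in a block of `S'`, compatibly with the orders of the
blocks. -/
def Refines (S S' : OrderedPartition n) : Prop :=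
  ∃ f : Fin S.blocks.length → Fin S'.blocks.length,
    Monotone f ∧ ∀ a, S.blocks.get a ⊆ S'.blocks.get (f a)

/-- The ordered partition `({π⁻¹(1)}, …, {π⁻¹(n)})` into singletons. -/
def ofPerm (π : Equiv.Perm (Fin n)) : OrderedPartition n where
  blocks := List.ofFn fun a => {π.symm a}
  nonempty := by simp [List.mem_ofFn]
  disjoint := by
    rw [List.pairwise_ofFn]
    intro i j hij
    simpa using hij.ne
  cover := fun x => ⟨{x}, by simpa [List.mem_ofFn] using π.symm.surjective x, by simp⟩

/-- `t_i = |S_1| + ⋯ + |S_i|`. The type of `S = (S_1, …, S_k)` is `(t_1, …, t_{k-1})`. -/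
def typeAt (S : OrderedPartition n) (i : ℕ) : ℕ := ((S.blocks.take i).map Finset.card).sum

theorem existsUnique_index (S : OrderedPartition n) (x : Fin n) :
    ∃! a : Fin S.blocks.length, x ∈ S.blocks.get a := by
  obtain ⟨B, hB, hx⟩ := S.cover x
  obtain ⟨a, ha, rfl⟩ := List.getElem_of_mem hB
  refine ⟨⟨a, ha⟩, hx, ?_⟩
  rintro ⟨b, hb⟩ hxb
  have hp := List.pairwise_iff_getElem.1 S.disjoint
  rcases lt_trichotomy a b with h | h | h
  · exact absurd hxb (Finset.disjoint_left.1 (hp a b ha hb h) hx)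
  · simp [h]
  · exact absurd hx (Finset.disjoint_left.1 (hp b a hb ha h) hxb)

theorem exists_index (S : OrderedPartition n) :
    ∃ f : Fin n → Fin S.blocks.length, ∀ x a, x ∈ S.blocks.get a ↔ f x = a := by
  choose f hf hu using S.existsUnique_index
  exact ⟨f, fun x a => ⟨fun h => (hu x a h).symm, fun h => h ▸ hf x⟩⟩

theorem refines_ofPerm_iff (S : OrderedPartition n) {f : Fin n → Fin S.blocks.length}
    (hf : ∀ x a, x ∈ S.blocks.get a ↔ f x = a) (π : Equiv.Perm (Fin n)) :
    (ofPerm π).Refines S ↔ Monotone (f ∘ π.symm) := by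
  have hl : (ofPerm π).blocks.length = n := by simp [ofPerm]
  constructor
  · rintro ⟨g, hg, h⟩
    have key : f ∘ π.symm = g ∘ Fin.cast hl.symm := by
      funext a
      have h₁ := h (Fin.cast hl.symm a)
      simp only [ofPerm, List.get_ofFn, Finset.singleton_subset_iff] at h₁
      exact (hf _ _).1 h₁
    rw [key]
    exact fun a b hab => hg (a := Fin.cast hl.symm a) (b := Fin.cast hl.symm b) hab
  · intro h
    refine ⟨fun a => f (π.symm (Fin.cast hl a)),
      fun a b hab => h (a := Fin.cast hl a) (b := Fin.cast hl b) hab, fun a => ?_⟩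
    have h₁ : (ofPerm π).blocks.get a = {π.symm (Fin.cast hl a)} :=
      List.get_ofFn _ _
    rw [h₁, Finset.singleton_subset_iff]
    exact (hf _ _).2 rfl

/-- Every ordered partition has a refinement into singletons. -/
theorem exists_refines (S : OrderedPartition n) :
    ∃ π : Equiv.Perm (Fin n), (ofPerm π).Refines S := by
  obtain ⟨f, hf⟩ := S.exists_index
  refine ⟨(Tuple.sort f).symm, (S.refines_ofPerm_iff hf _).2 ?_⟩
  simpa using Tuple.monotone_sort f

end OrderedPartition

/-! ### Partition labeled trees and the Kapranov poset -/

/-- `[d+1]`-partition labeled trees: a strictly branching plane rooted tree with `k` leaves, and an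
ordered partition of `[d+1]` into `k` blocks, which label the leaves from left to right. (The number
of leaves is then at most `d + 1`, because the blocks are nonempty.) -/
structure PartitionLabeledTree (d : ℕ) where
  part : OrderedPartition (d + 1)
  tree : PlaneTree
  branching : tree.StrictlyBranching
  length_eq : part.blocks.length = tree.numLeaves

namespace PartitionLabeledTree

variable {d : ℕ}

/-- The relation `⋖_KP`: either an internal edge is contracted and the partition is kept, or a
minimal internal vertex, whose children are the leaves `ℓ_{a+1}, …, ℓ_{a+m}`, becomes a
leaf labeled by the union of the blocks `S_{a+1}, …, S_{a+m}`. -/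
inductive Step (P Q : PartitionLabeledTree d) : Prop
  | contract (hpart : P.part = Q.part) (htree : P.tree.ContractEdge Q.tree)
  | collapse (a m : ℕ) (htree : P.tree.CollapseVertex a m Q.tree)
      (hpart : Q.part.blocks = P.part.blocks.take a ++
        ((P.part.blocks.drop a).take m).foldr (· ∪ ·) ∅ :: P.part.blocks.drop (a + m))

theorem Step.numInternal_lt {P Q : PartitionLabeledTree d} (h : Step P Q) :
    Q.tree.numInternal < P.tree.numInternal := by
  cases h with
  | contract _ h => exact h.numInternal_lt
  | collapse a m h _ => exact h.numInternal_lt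

theorem eq_or_lt_of_reflTransGen {P Q : PartitionLabeledTree d}
    (h : Relation.ReflTransGen Step P Q) :
    P = Q ∨ Q.tree.numInternal < P.tree.numInternal := by
  induction h with
  | refl => exact Or.inl rfl
  | tail _ hs ih =>
    have := hs.numInternal_lt
    rcases ih with rfl | ih
    · exact Or.inr this
    · exact Or.inr (this.trans ih)

/-- The partial order `≤_KP`, generated by `⋖_KP`. -/
instance : PartialOrder (PartitionLabeledTree d) where
  le := Relation.ReflTransGen Step
  le_refl _ := Relation.ReflTransGen.refl
  le_trans _ _ _ := Relation.ReflTransGen.trans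
  le_antisymm P Q h₁ h₂ := by
    rcases eq_or_lt_of_reflTransGen h₁ with h | h
    · exact h
    · rcases eq_or_lt_of_reflTransGen h₂ with h' | h'
      · exact h'.symm
      · exact absurd h h'.asymm

end PartitionLabeledTree

/-- The Kapranov poset: the partition labeled trees with a minimum `0̂` added. -/
abbrev KapranovPoset (d : ℕ) : Type := WithBot (PartitionLabeledTree d)

/-! ### The cones -/

/-- The space `W_d`, the quotient of `ℝ^{d+1}` by the line spanned by `(1, …, 1)`. -/
abbrev W (d : ℕ) : Type :=
  (Fin (d + 1) → ℝ) ⧸ Submodule.span ℝ {(1 : Fin (d + 1) → ℝ)}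

/-- The linear functional `w ↦ w_x - w_y` on `W_d`. -/
def coordDiff {d : ℕ} (x y : Fin (d + 1)) : W d →ₗ[ℝ] ℝ :=
  (Submodule.span ℝ {(1 : Fin (d + 1) → ℝ)}).liftQ
    (LinearMap.proj (R := ℝ) (φ := fun _ => ℝ) x - LinearMap.proj (R := ℝ) (φ := fun _ => ℝ) y)
    (by simp [Submodule.span_singleton_le_iff_mem])

/-- `D^π_{i+1} w = w_{π⁻¹(i+2)} - w_{π⁻¹(i+1)}` with one-based indices, for `0 ≤ i < d`. -/
def D {d : ℕ} (π : Equiv.Perm (Fin (d + 1))) (i : Fin d) : W d →ₗ[ℝ] ℝ :=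
  coordDiff (π.symm i.succ) (π.symm i.castSucc)

/-- The subspace `W_S` of all `w` with `w_x = w_y` whenever `x` and `y` are in one block of `S`. -/
def WS {d : ℕ} (S : OrderedPartition (d + 1)) : Set (W d) :=
  {w | ∀ x y, S.Equiv x y → coordDiff x y w = 0}

/-- If `S(π)` and `S(π')` both refine `S`, then `D^π` and `D^π'` agree on `W_S`. -/
theorem D_eq_of_refines {d : ℕ} {S : OrderedPartition (d + 1)} {π π' : Equiv.Perm (Fin (d + 1))}
    (h : (OrderedPartition.ofPerm π).Refines S) (h' : (OrderedPartition.ofPerm π').Refines S)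
    {w : W d} (hw : w ∈ WS S) (i : Fin d) : D π i w = D π' i w := by
  obtain ⟨f, hf⟩ := S.exists_index
  have key := Tuple.unique_monotone ((S.refines_ofPerm_iff hf π).1 h)
    ((S.refines_ofPerm_iff hf π').1 h')
  have hle : ∀ x y, f x = f y → S.Le x y := fun x y hxy =>
    ⟨f x, f y, hxy.le, (hf _ _).2 rfl, (hf _ _).2 rfl⟩
  have hz : ∀ a, coordDiff (π.symm a) (π'.symm a) w = 0 := fun a =>
    hw _ _ ⟨hle _ _ (congrFun key a), hle _ _ (congrFun key a).symm⟩
  have h₁ := hz i.succ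
  have h₂ := hz i.castSucc
  induction w using Submodule.Quotient.induction_on with
  | H v =>
    simp only [D, coordDiff, Submodule.liftQ_apply, LinearMap.sub_apply, LinearMap.proj_apply]
      at h₁ h₂ ⊢
    linarith

namespace PartitionLabeledTree

variable {d : ℕ}

/-- The preorder `⪯_{(S,T)}` on the type `{t_1, …, t_{k-1}}` of `S`: `t_i ⪯ t_j` if the internal
vertex of `T` labeled `j` is an ancestor of (or equal to) the one labeled `i`. -/
def Prec (P : PartitionLabeledTree d) (p q : ℕ) : Prop :=
  ∃ i j : ℕ, (1 ≤ i ∧ i < P.tree.numLeaves) ∧ (1 ≤ j ∧ j < P.tree.numLeaves) ∧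
    p = P.part.typeAt i ∧ q = P.part.typeAt j ∧
    P.tree.labeledVertex j <+: P.tree.labeledVertex i

/-- `l` is a minimal element of the preorder `⪯_{(S,T)}` on the type of `S`. -/
def IsMinimalLabel (P : PartitionLabeledTree d) (l : ℕ) : Prop :=
  (∃ i : ℕ, 1 ≤ i ∧ i < P.tree.numLeaves ∧ l = P.part.typeAt i) ∧ ∀ m, P.Prec m l → P.Prec l m

/-- The set that defines `σ(S,T)`, written with the permutation `π`. -/
def coneWith (P : PartitionLabeledTree d) (π : Equiv.Perm (Fin (d + 1))) : Set (W d) :=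
  {w | w ∈ WS P.part ∧
    (∀ i j : Fin d, P.Prec (i + 1) (j + 1) → D π i w ≤ D π j w) ∧
    ∀ l : Fin d, P.IsMinimalLabel (l + 1) → 0 ≤ D π l w}

/-- The cone `σ(S,T)`: choose `π` such that `S(π)` refines `S`. -/
noncomputable def cone (P : PartitionLabeledTree d) : Set (W d) :=
  P.coneWith P.part.exists_refines.choose

/-- The cone `σ(S,T)` does not depend on the choice of `π`. -/
theorem cone_eq (P : PartitionLabeledTree d) {π : Equiv.Perm (Fin (d + 1))}
    (h : (OrderedPartition.ofPerm π).Refines P.part) : P.cone = P.coneWith π := by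
  ext w
  have hD := fun hw i => D_eq_of_refines P.part.exists_refines.choose_spec h (w := w) hw i
  constructor
  · rintro ⟨hw, h₁, h₂⟩
    exact ⟨hw, fun i j hij => hD hw i ▸ hD hw j ▸ h₁ i j hij, fun l hl => hD hw l ▸ h₂ l hl⟩
  · rintro ⟨hw, h₁, h₂⟩
    exact ⟨hw, fun i j hij => (hD hw i).symm ▸ (hD hw j).symm ▸ h₁ i j hij,
      fun l hl => (hD hw l).symm ▸ h₂ l hl⟩

end PartitionLabeledTree

/-- The collection `Ξ_d` of all the cones `σ(S,T)`. -/
def Xi (d : ℕ) : Set (Set (W d)) := {C | ∃ P : PartitionLabeledTree d, C = P.cone}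

/-- `F` is a face of the polyhedron `C`: the set of the points of `C` where some linear functional is
maximal on `C`, or (by convention) the empty set. -/
def IsFace {d : ℕ} (C F : Set (W d)) : Prop :=
  F = ∅ ∨ ∃ l : W d →ₗ[ℝ] ℝ, F = {x | x ∈ C ∧ ∀ y ∈ C, l y ≤ l x}

end PermutoAssoc

-- Plane trees: induction, leaf counts and strict branching.

namespace PermutoAssoc
namespace PlaneTree

-- If `w` is constant on the blocks of `S`, its gaps `D^π w` vanish away from the type of `S`, so
-- `w` amounts to a function `g` on the gaps between consecutive leaves of `T`. Lying in the cone
-- then means that the gaps at one vertex share a value, that values are nonnegative, and that they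
-- weakly increase towards the root (`Mono`, `mem_coneWith_iff`). Points at which these inequalities
-- are strict act as relative interior points, and four facts carry the proof.
--
-- Every labeled tree has a strict point (`exists_monoMem_strict`). A strict point determines its
-- labeled tree: the order of the coordinates gives `S`, and the gaps of maximal value show where
-- `T` splits at the root, recursively (`MonoMem.eq`). If a point of the cone of `P` is not strict,
-- then some vertex has the value of its parent, or some vertex with only leaf children has value 0;
-- either way the point lies in the cone of some `Q` covering `P`, so by induction it is strict for
-- some `Q ≥ P` (`exists_le_strict`). Each covering step cuts the smaller cone out of the larger by
-- `φ = 0`, with `φ` nonnegative on the larger (`Step.exists_coneWith_eq`).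
--
-- Hence an inclusion of the cone of `Q` in that of `P` already forces `P ≤ Q`: a strict point of
-- `Q` is strict for some `R ≥ P`, and `R = Q`. This gives one direction, since faces are subsets,
-- and injectivity by antisymmetry. Conversely, a chain of covering steps makes the cone of `Q`
-- extreme in that of `P`, and extreme subcones of polyhedral cones are exposed
-- (`isFace_of_isExtremeSubcone`).

theorem induction_on_children {p : PlaneTree → Prop}
    (h : ∀ cs : List PlaneTree, (∀ c ∈ cs, p c) → p (node cs)) (T : PlaneTree) : p T :=
  PlaneTree.rec (motive_1 := p) (motive_2 := fun cs => ∀ c ∈ cs, p c)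
    (fun cs hcs => h cs hcs) (by simp) (fun c cs hc hcs => by
      intro d hd
      rcases List.mem_cons.1 hd with rfl | hd
      · exact hc
      · exact hcs d hd) T

/-- The total number of leaves of a list of trees. -/
def forestLeaves (cs : List PlaneTree) : ℕ := (cs.map numLeaves).sum

@[simp] theorem forestLeaves_nil : forestLeaves [] = 0 := rfl

@[simp] theorem forestLeaves_cons (c : PlaneTree) (cs : List PlaneTree) :
    forestLeaves (c :: cs) = c.numLeaves + forestLeaves cs := by simp [forestLeaves]

@[simp] theorem forestLeaves_append (l r : List PlaneTree) :
    forestLeaves (l ++ r) = forestLeaves l + forestLeaves r := by simp [forestLeaves]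

theorem length_forestLeafPaths (p : ℕ) (cs : List PlaneTree) :
    (forestLeafPaths p cs).length = forestLeaves cs := by
  induction cs generalizing p with
  | nil => simp [forestLeafPaths]
  | cons c cs ih => simp [forestLeafPaths, ih, numLeaves]

@[simp] theorem numLeaves_leaf : leaf.numLeaves = 1 := by simp [leaf, numLeaves, leafPaths]

theorem numLeaves_node {cs : List PlaneTree} (h : cs ≠ []) :
    (node cs).numLeaves = forestLeaves cs := by
  cases cs with
  | nil => exact absurd rfl h
  | cons c cs => rw [numLeaves, leafPaths, length_forestLeafPaths]

theorem numLeaves_pos (T : PlaneTree) : 0 < T.numLeaves := by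
  induction T using induction_on_children with
  | h cs ih =>
    cases cs with
    | nil => exact numLeaves_leaf ▸ one_pos
    | cons c cs =>
      rw [numLeaves_node (by simp), forestLeaves_cons]
      have := ih c (by simp)
      omega

theorem forestLeaves_pos {cs : List PlaneTree} (h : cs ≠ []) : 0 < forestLeaves cs := by
  cases cs with
  | nil => exact absurd rfl h
  | cons c cs =>
    have := c.numLeaves_pos
    rw [forestLeaves_cons]
    omega

theorem strictlyBranching_node_iff {cs : List PlaneTree} :
    (node cs).StrictlyBranching ↔
      cs = [] ∨ (2 ≤ cs.length ∧ ∀ c ∈ cs, c.StrictlyBranching) := by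
  constructor
  · intro h
    cases h with
    | leaf => exact Or.inl rfl
    | node _ h₁ h₂ => exact Or.inr ⟨h₁, h₂⟩
  · rintro (rfl | ⟨h₁, h₂⟩)
    · exact StrictlyBranching.leaf
    · exact StrictlyBranching.node _ h₁ h₂

theorem StrictlyBranching.of_mem {cs : List PlaneTree} (h : (PlaneTree.node cs).StrictlyBranching)
    {c : PlaneTree} (hc : c ∈ cs) : c.StrictlyBranching := by
  rcases strictlyBranching_node_iff.1 h with rfl | ⟨-, h⟩
  · simp at hc
  · exact h c hc

theorem StrictlyBranching.two_le_length {cs : List PlaneTree} (h : (PlaneTree.node cs).StrictlyBranching)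
    (hc : cs ≠ []) : 2 ≤ cs.length := by
  rcases strictlyBranching_node_iff.1 h with rfl | ⟨h, -⟩
  · exact absurd rfl hc
  · exact h

theorem StrictlyBranching.replace {l r : List PlaneTree} {t t' : PlaneTree}
    (h : (PlaneTree.node (l ++ t :: r)).StrictlyBranching) (h' : t'.StrictlyBranching) :
    (PlaneTree.node (l ++ t' :: r)).StrictlyBranching := by
  refine StrictlyBranching.node _ ?_ fun c hc => ?_
  · simpa using h.two_le_length (by simp)
  · have hm := fun c hc => h.of_mem (c := c) hc
    simp only [List.mem_append, List.mem_cons] at hc hm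
    rcases hc with hc | rfl | hc
    · exact hm c (Or.inl hc)
    · exact h'
    · exact hm c (Or.inr (Or.inr hc))

theorem ContractEdge.strictlyBranching {T T' : PlaneTree} (h : ContractEdge T T')
    (hT : T.StrictlyBranching) : T'.StrictlyBranching := by
  induction h with
  | root l r cs hcs =>
    have hn : (node cs).StrictlyBranching := hT.of_mem (by simp)
    refine StrictlyBranching.node _ ?_ fun c hc => ?_
    · have := hn.two_le_length hcs
      simp only [List.length_append]
      omega
    · simp only [List.mem_append] at hc
      rcases hc with (hc | hc) | hc
      · exact hT.of_mem (by simp [hc])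
      · exact hn.of_mem hc
      · exact hT.of_mem (by simp [hc])
  | child l r h ih => exact hT.replace (ih (hT.of_mem (by simp)))

theorem CollapseVertex.strictlyBranching {T T' : PlaneTree} {a m : ℕ}
    (h : CollapseVertex T a m T') (hT : T.StrictlyBranching) : T'.StrictlyBranching := by
  induction h with
  | root m hm => exact StrictlyBranching.leaf
  | child l r h ih => exact hT.replace (ih (hT.of_mem (by simp)))

theorem ContractEdge.numLeaves_eq {T T' : PlaneTree} (h : ContractEdge T T') :
    T'.numLeaves = T.numLeaves := by
  induction h with
  | root l r cs hcs =>
    rw [numLeaves_node (by simp [hcs]), numLeaves_node (by simp)]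
    simp [numLeaves_node hcs]
  | child l r h ih =>
    rw [numLeaves_node (by simp), numLeaves_node (by simp)]
    simp [ih]

theorem forestLeaves_replicate_leaf (m : ℕ) : forestLeaves (List.replicate m leaf) = m := by
  simp [forestLeaves]

theorem CollapseVertex.numLeaves_add {T T' : PlaneTree} {a m : ℕ} (h : CollapseVertex T a m T') :
    T'.numLeaves + m = T.numLeaves + 1 ∧ a + m ≤ T.numLeaves := by
  induction h with
  | root m hm =>
    rw [numLeaves_node (by simpa using hm), forestLeaves_replicate_leaf]
    simp [add_comm]
  | child l r h ih =>
    rw [numLeaves_node (by simp), numLeaves_node (by simp)]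
    simp only [forestLeaves_append, forestLeaves_cons]
    simp only [forestLeaves]
    omega

theorem CollapseVertex.two_le {T T' : PlaneTree} {a m : ℕ} (h : CollapseVertex T a m T')
    (hT : T.StrictlyBranching) : 2 ≤ m := by
  induction h with
  | root m hm => simpa using hT.two_le_length (by simpa using hm)
  | child l r h ih => exact ih (hT.of_mem (by simp))

/-! ### Monotone gap functions -/

mutual
/-- The gap between the `i`-th and the `(i+1)`-st leaf of a tree (counted from the offset `o`) has
the value `g i`. The relation `Mono r T o g` says that the gaps with the same closest common ancestor
have the same value, that this value is `r`-larger than `0`, and that it is `r`-larger than the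
values at the descendants of this vertex. -/
def Mono (r : ℝ → ℝ → Prop) : PlaneTree → ℕ → (ℕ → ℝ) → Prop
  | node cs, o, g => ∃ x, r 0 x ∧ ForestMono r x cs o g
/-- The version of `Mono` for the list of the children of a vertex with value `x`. -/
def ForestMono (r : ℝ → ℝ → Prop) (x : ℝ) : List PlaneTree → ℕ → (ℕ → ℝ) → Prop
  | [], _, _ => True
  | c :: cs, o, g => Mono r c o g ∧ (∀ i, o ≤ i → i + 1 < o + c.numLeaves → r (g i) x) ∧
      (∀ i, i + 1 = o + c.numLeaves → cs ≠ [] → g i = x) ∧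
      ForestMono r x cs (o + c.numLeaves) g
end

variable {r : ℝ → ℝ → Prop}

theorem mono_node {cs : List PlaneTree} {o : ℕ} {g : ℕ → ℝ} :
    Mono r (node cs) o g ↔ ∃ x, r 0 x ∧ ForestMono r x cs o g := by
  rw [Mono]

theorem forestMono_nil {x : ℝ} {o : ℕ} {g : ℕ → ℝ} : ForestMono r x [] o g := by
  simp [ForestMono]

theorem forestMono_cons {x : ℝ} {c : PlaneTree} {cs : List PlaneTree} {o : ℕ} {g : ℕ → ℝ} :
    ForestMono r x (c :: cs) o g ↔ Mono r c o g ∧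
      (∀ i, o ≤ i → i + 1 < o + c.numLeaves → r (g i) x) ∧
      (∀ i, i + 1 = o + c.numLeaves → cs ≠ [] → g i = x) ∧
      ForestMono r x cs (o + c.numLeaves) g := by
  rw [ForestMono]

theorem forestMono_append {x : ℝ} {l m : List PlaneTree} {o : ℕ} {g : ℕ → ℝ} :
    ForestMono r x (l ++ m) o g ↔ ForestMono r x l o g ∧
      (∀ i, i + 1 = o + forestLeaves l → l ≠ [] → m ≠ [] → g i = x) ∧
      ForestMono r x m (o + forestLeaves l) g := by
  induction l generalizing o with
  | nil => simp [forestMono_nil]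
  | cons c cs ih =>
    rw [List.cons_append, forestMono_cons, ih, forestMono_cons, forestLeaves_cons, ← add_assoc]
    by_cases hcs : cs = []
    · subst hcs
      simp [forestMono_nil]
      tauto
    · simp [hcs]
      tauto

theorem mono_leaf (hr : ∃ x, r 0 x) {o : ℕ} {g : ℕ → ℝ} : Mono r leaf o g := by
  obtain ⟨x, hx⟩ := hr
  exact mono_node.2 ⟨x, hx, forestMono_nil⟩

/-- Only the gaps inside the tree enter the condition, so the offset may be shifted and all other
values changed. This allows gap functions to be cut and glued. -/
theorem Mono.congr {T : PlaneTree} {o o' : ℕ} {g g' : ℕ → ℝ} (h : Mono r T o g)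
    (hg : ∀ i, i + 1 < T.numLeaves → g (o + i) = g' (o' + i)) : Mono r T o' g' := by
  induction T using induction_on_children generalizing o o' with
  | h cs ih =>
    obtain ⟨x, hx, h⟩ := mono_node.1 h
    refine mono_node.2 ⟨x, hx, ?_⟩
    have hg' : ∀ i, i + 1 < forestLeaves cs → g (o + i) = g' (o' + i) := by
      intro i hi
      refine hg i ?_
      rwa [numLeaves_node (by rintro rfl; simp at hi)]
    clear hg
    induction cs generalizing o o' with
    | nil => exact forestMono_nil
    | cons c cs ihc =>
      obtain ⟨h₁, h₂, h₃, h₄⟩ := forestMono_cons.1 h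
      rw [forestLeaves_cons] at hg'
      refine forestMono_cons.2 ⟨ih c (by simp) h₁ fun i hi => hg' i (by omega), ?_, ?_, ?_⟩
      · intro i hi hi'
        obtain ⟨j, rfl⟩ := Nat.exists_eq_add_of_le hi
        rw [← hg' j (by omega)]
        exact h₂ _ (by omega) (by omega)
      · intro i hi hcs
        have := forestLeaves_pos hcs
        have := c.numLeaves_pos
        obtain ⟨j, rfl⟩ := Nat.exists_eq_add_of_le (show o' ≤ i by omega)
        rw [← hg' j (by omega)]
        exact h₃ _ (by omega) hcs
      · refine ihc (fun d hd => ih d (by simp [hd])) (mono_node.2 ⟨x, hx, h₄⟩) h₄ ?_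
        intro i hi
        rw [add_assoc, add_assoc]
        exact hg' _ (by omega)

theorem ForestMono.congr {x : ℝ} {cs : List PlaneTree} {o o' : ℕ} {g g' : ℕ → ℝ}
    (h : ForestMono r x cs o g)
    (hg : ∀ i, i + 1 < forestLeaves cs → g (o + i) = g' (o' + i)) : ForestMono r x cs o' g' := by
  induction cs generalizing o o' with
  | nil => exact forestMono_nil
  | cons c cs ih =>
    obtain ⟨h₁, h₂, h₃, h₄⟩ := forestMono_cons.1 h
    rw [forestLeaves_cons] at hg
    refine forestMono_cons.2 ⟨h₁.congr fun i hi => hg i (by omega), ?_, ?_, ?_⟩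
    · intro i hi hi'
      obtain ⟨j, rfl⟩ := Nat.exists_eq_add_of_le hi
      rw [← hg j (by omega)]
      exact h₂ _ (by omega) (by omega)
    · intro i hi hcs
      have := forestLeaves_pos hcs
      have := c.numLeaves_pos
      obtain ⟨j, rfl⟩ := Nat.exists_eq_add_of_le (show o' ≤ i by omega)
      rw [← hg j (by omega)]
      exact h₃ _ (by omega) hcs
    · refine ih h₄ ?_
      intro i hi
      rw [add_assoc, add_assoc]
      exact hg _ (by omega)

/-- A gap lies either inside one of the children, or between two of them, where the value is that of
the parent. -/
theorem ForestMono.rel_or_eq {x : ℝ} {cs : List PlaneTree} {o : ℕ} {g : ℕ → ℝ}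
    (h : ForestMono r x cs o g) {i : ℕ} (hi : o ≤ i) (hi' : i + 1 < o + forestLeaves cs) :
    r (g i) x ∨ g i = x := by
  induction cs generalizing o with
  | nil => simp at hi'; omega
  | cons c cs ih =>
    obtain ⟨h₁, h₂, h₃, h₄⟩ := forestMono_cons.1 h
    rw [forestLeaves_cons] at hi'
    rcases lt_trichotomy (i + 1) (o + c.numLeaves) with hlt | heq | hgt
    · exact Or.inl (h₂ i hi hlt)
    · refine Or.inr (h₃ i heq ?_)
      rintro rfl
      simp at hi'
      omega
    · exact ih h₄ (by omega) (by omega)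

/-- Each gap takes the value of some vertex, and positivity is demanded at every vertex; no
transitivity of `r` is needed. -/
theorem Mono.rel_zero {T : PlaneTree} {o : ℕ} {g : ℕ → ℝ} (h : Mono r T o g) {i : ℕ}
    (hi : o ≤ i) (hi' : i + 1 < o + T.numLeaves) : r 0 (g i) := by
  induction T using induction_on_children generalizing o with
  | h cs ih =>
    obtain ⟨x, hx, h⟩ := mono_node.1 h
    have hcs : cs ≠ [] := by
      rintro rfl
      have := numLeaves_leaf
      rw [leaf] at this
      omega
    rw [numLeaves_node hcs] at hi'
    clear hcs
    induction cs generalizing o with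
    | nil => simp at hi'; omega
    | cons c cs ihc =>
      obtain ⟨h₁, h₂, h₃, h₄⟩ := forestMono_cons.1 h
      rw [forestLeaves_cons] at hi'
      rcases lt_trichotomy (i + 1) (o + c.numLeaves) with hlt | heq | hgt
      · exact ih c (by simp) h₁ hi hlt
      · rw [h₃ i heq ?_]
        · exact hx
        rintro rfl
        simp at hi'
        omega
      · exact ihc (fun d hd => ih d (by simp [hd])) (mono_node.2 ⟨x, hx, h₄⟩) (by omega)
          (by omega) h₄

/-- A strictly monotone gap function is weakly monotone. -/
theorem Mono.of_strict {T : PlaneTree} {o : ℕ} {g : ℕ → ℝ} (h : Mono (· < ·) T o g) :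
    Mono (· ≤ ·) T o g := by
  induction T using induction_on_children generalizing o with
  | h cs ih =>
    obtain ⟨x, hx, h⟩ := mono_node.1 h
    refine mono_node.2 ⟨x, hx.le, ?_⟩
    induction cs generalizing o with
    | nil => exact forestMono_nil
    | cons c cs ihc =>
      obtain ⟨h₁, h₂, h₃, h₄⟩ := forestMono_cons.1 h
      exact forestMono_cons.2 ⟨ih c (by simp) h₁, fun i hi hi' => (h₂ i hi hi').le, h₃,
        ihc (fun d hd => ih d (by simp [hd])) (mono_node.2 ⟨x, hx, h₄⟩) h₄⟩

/-- In a list of at least two trees there is a gap between the trees. -/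
theorem exists_separator {cs : List PlaneTree} (h : 2 ≤ cs.length) (o : ℕ) :
    ∃ j, o ≤ j ∧ j + 1 < o + forestLeaves cs ∧
      ∀ (r : ℝ → ℝ → Prop) (x : ℝ) (g : ℕ → ℝ), ForestMono r x cs o g → g j = x := by
  match cs, h with
  | c :: c' :: cs, _ =>
    have := c.numLeaves_pos
    have := c'.numLeaves_pos
    -- The gap between the first two children. It is chosen before `g`, so that evaluating there is
    -- a fixed linear functional.
    refine ⟨o + c.numLeaves - 1, by omega, by simp; omega, fun r x g hg => ?_⟩
    exact (forestMono_cons.1 hg).2.2.1 _ (by omega) (by simp)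

end PlaneTree
end PermutoAssoc

-- Contraction, collapse and strictness of gap functions.

namespace PermutoAssoc
namespace PlaneTree

variable {r : ℝ → ℝ → Prop}

/-- Contraction identifies the two ends of an edge, so it turns the inequality between their values
into an equality. Here `i` is a gap at the lower end and `j` one at the upper end; neither depends
on `g`, so `g j - g i` is linear in `g`. -/
theorem ContractEdge.exists_mono_iff {T T' : PlaneTree} (h : ContractEdge T T')
    (hT : T.StrictlyBranching) (o : ℕ) :
    ∃ i j, (o ≤ i ∧ i + 1 < o + T.numLeaves) ∧ (o ≤ j ∧ j + 1 < o + T.numLeaves) ∧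
      ∀ g : ℕ → ℝ, (Mono (· ≤ ·) T o g → g i ≤ g j) ∧
        (Mono (· ≤ ·) T' o g ↔ Mono (· ≤ ·) T o g ∧ g i = g j) := by
  induction h generalizing o with
  | root l r cs hcs =>
    have hn : (node cs).StrictlyBranching := hT.of_mem (by simp)
    obtain ⟨i, hi, hi', hsi⟩ := exists_separator (hn.two_le_length hcs) (o + forestLeaves l)
    obtain ⟨j, hj, hj', hsj⟩ := exists_separator (hT.two_le_length (by simp)) o
    have hnc := numLeaves_node hcs
    refine ⟨i, j, ⟨by omega, ?_⟩, ⟨hj, ?_⟩, fun g => ?_⟩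
    · rw [numLeaves_node (by simp), forestLeaves_append, forestLeaves_cons, hnc]
      omega
    · rwa [numLeaves_node (by simp)]
    have key : ∀ x, ForestMono (· ≤ ·) x (l ++ node cs :: r) o g → g j = x ∧
        ∃ y, ForestMono (· ≤ ·) y cs (o + forestLeaves l) g ∧ g i = y ∧ y ≤ x := by
      intro x hx
      obtain ⟨-, -, hx'⟩ := forestMono_append.1 hx
      obtain ⟨h₁, h₂, -, -⟩ := forestMono_cons.1 hx'
      obtain ⟨y, -, hy⟩ := mono_node.1 h₁
      have hiy := hsi _ _ _ hy
      exact ⟨hsj _ _ _ hx, y, hy, hiy, hiy ▸ h₂ i hi (by omega)⟩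
    constructor
    · intro hg
      obtain ⟨x, -, hx⟩ := mono_node.1 hg
      obtain ⟨hjx, y, -, hiy, hyx⟩ := key x hx
      rwa [hiy, hjx]
    constructor
    · intro hg
      obtain ⟨x, h0, hx⟩ := mono_node.1 hg
      rw [List.append_assoc, forestMono_append, forestMono_append] at hx
      obtain ⟨h₁, h₂, h₃, h₄, h₅⟩ := hx
      -- Splitting the merged vertex again, both ends receive the value `x`.
      have hF : ForestMono (· ≤ ·) x (l ++ node cs :: r) o g := by
        refine forestMono_append.2 ⟨h₁, fun k hk hl _ => h₂ k hk hl (by simp [hcs]),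
          forestMono_cons.2 ⟨mono_node.2 ⟨x, h0, h₃⟩, fun k hk hk' => ?_, fun k hk hr => ?_, ?_⟩⟩
        · rcases h₃.rel_or_eq hk (by omega) with h | h
          · exact h
          · exact h.le
        · exact h₄ k (by omega) hcs hr
        · rwa [hnc]
      exact ⟨mono_node.2 ⟨x, h0, hF⟩, by rw [hsi _ _ _ h₃, hsj _ _ _ hF]⟩
    · rintro ⟨hg, hij⟩
      obtain ⟨x, h0, hx⟩ := mono_node.1 hg
      obtain ⟨hjx, y, hy, hiy, hyx⟩ := key x hx
      obtain rfl : y = x := by rw [← hiy, ← hjx, hij]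
      obtain ⟨h₁, h₂, h₃⟩ := forestMono_append.1 hx
      obtain ⟨-, -, h₄, h₅⟩ := forestMono_cons.1 h₃
      refine mono_node.2 ⟨y, h0, ?_⟩
      rw [List.append_assoc, forestMono_append, forestMono_append]
      exact ⟨h₁, fun k hk hl _ => h₂ k hk hl (by simp), hy,
        fun k hk _ hr => h₄ k (by omega) hr, hnc ▸ h₅⟩
  | @child l r t t' h ih =>
    obtain ⟨i, j, ⟨hi, hi'⟩, ⟨hj, hj'⟩, hg⟩ := ih (hT.of_mem (by simp)) (o + forestLeaves l)
    have hn := h.numLeaves_eq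
    have hN : (node (l ++ t :: r)).numLeaves = forestLeaves l + (t.numLeaves + forestLeaves r) := by
      rw [numLeaves_node (by simp), forestLeaves_append, forestLeaves_cons]
    refine ⟨i, j, ⟨by omega, by omega⟩, ⟨by omega, by omega⟩, fun g => ⟨?_, ?_⟩⟩
    · intro h
      obtain ⟨x, -, hx⟩ := mono_node.1 h
      exact (hg g).1 (forestMono_cons.1 (forestMono_append.1 hx).2.2).1
    · simp only [mono_node, forestMono_append, forestMono_cons, hn, (hg g).2]
      constructor
      · rintro ⟨x, h0, h₁, h₂, ⟨h₃, h₃'⟩, h₄⟩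
        exact ⟨⟨x, h0, h₁, fun k hk hl _ => h₂ k hk hl (by simp), h₃, h₄⟩, h₃'⟩
      · rintro ⟨⟨x, h0, h₁, h₂, h₃, h₄⟩, h₃'⟩
        exact ⟨x, h0, h₁, fun k hk hl _ => h₂ k hk hl (by simp), ⟨h₃, h₃'⟩, h₄⟩

theorem forestMono_replicate_leaf {x : ℝ} {m o : ℕ} {g : ℕ → ℝ} :
    ForestMono (· ≤ ·) x (List.replicate m leaf) o g ↔ ∀ i, i + 1 < m → g (o + i) = x := by
  induction m generalizing o with
  | zero => simp [forestMono_nil]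
  | succ m ih =>
    rw [List.replicate_succ, forestMono_cons, ih, numLeaves_leaf]
    constructor
    · rintro ⟨-, -, h₁, h₂⟩ i hi
      cases i with
      | zero => exact h₁ o rfl (by rw [ne_eq, List.replicate_eq_nil_iff]; omega)
      | succ i => rw [← h₂ i (by omega), add_assoc, add_comm 1]
    · intro h
      refine ⟨mono_leaf ⟨0, le_rfl⟩, fun i hi hi' => by omega, fun i hi hm => ?_, fun i hi => ?_⟩
      · obtain rfl : i = o := by omega
        rw [ne_eq, List.replicate_eq_nil_iff] at hm
        exact h 0 (by omega)
      · rw [add_assoc, add_comm 1]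
        exact h _ (by omega)

/-- Here `g'` is `g` with the `m - 1` gaps of the collapsed vertex deleted. These gaps share one
value, so the vanishing of the first of them is the vanishing of all; and zeros can be put back
because 0 is the least admissible value. -/
theorem CollapseVertex.mono_iff {T T' : PlaneTree} {a m : ℕ} (h : CollapseVertex T a m T')
    (hT : T.StrictlyBranching) {o : ℕ} {g g' : ℕ → ℝ}
    (hlt : ∀ i < a, g' (o + i) = g (o + i)) (hge : ∀ i ≥ a, g' (o + i) = g (o + i + (m - 1))) :
    (Mono (· ≤ ·) T' o g' ∧ ∀ i, a ≤ i → i + 1 < a + m → g (o + i) = 0) ↔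
      Mono (· ≤ ·) T o g ∧ g (o + a) = 0 := by
  induction h generalizing o with
  | root m hm =>
    have hm2 := (CollapseVertex.root m hm).two_le hT
    constructor
    · rintro ⟨-, h⟩
      exact ⟨mono_node.2 ⟨0, le_rfl, forestMono_replicate_leaf.2 fun i hi =>
        h i (by omega) (by omega)⟩, h 0 le_rfl (by omega)⟩
    · rintro ⟨h, h0⟩
      obtain ⟨x, -, hx⟩ := mono_node.1 h
      rw [forestMono_replicate_leaf] at hx
      obtain rfl : x = 0 := by rw [← hx 0 (by omega), h0]
      exact ⟨mono_leaf ⟨0, le_rfl⟩, fun i _ hi => hx i (by omega)⟩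
  | @child l r t t' a m h ih =>
    have hm := h.two_le (hT.of_mem (by simp))
    obtain ⟨hn, ha⟩ := h.numLeaves_add
    change ∀ i < forestLeaves l + a, _ at hlt
    change ∀ i ≥ forestLeaves l + a, _ at hge
    change (_ ∧ ∀ i, forestLeaves l + a ≤ i → i + 1 < forestLeaves l + a + m → _) ↔
      _ ∧ g (o + (forestLeaves l + a)) = 0
    have IH := ih (hT.of_mem (by simp)) (o := o + forestLeaves l)
      (fun i hi => by rw [add_assoc]; exact hlt _ (by omega))
      (fun i hi => by rw [add_assoc]; exact hge _ (by omega))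
    have hl : ∀ x, ForestMono (· ≤ ·) x l o g' ↔ ForestMono (· ≤ ·) x l o g := fun x =>
      ⟨fun h => h.congr fun i hi => hlt i (by omega),
        fun h => h.congr fun i hi => (hlt i (by omega)).symm⟩
    have hr' : ∀ i, g' (o + forestLeaves l + t'.numLeaves + i) =
        g (o + forestLeaves l + t.numLeaves + i) := by
      intro i
      rw [add_assoc, add_assoc, hge _ (by omega)]
      congr 1
      omega
    have hr : ∀ x, ForestMono (· ≤ ·) x r (o + forestLeaves l + t'.numLeaves) g' ↔
        ForestMono (· ≤ ·) x r (o + forestLeaves l + t.numLeaves) g := fun x =>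
      ⟨fun h => h.congr fun i _ => hr' i, fun h => h.congr fun i _ => (hr' i).symm⟩
    have hsl : ∀ i, i + 1 = o + forestLeaves l → l ≠ [] → g' i = g i := by
      intro i hi hl
      have := forestLeaves_pos hl
      obtain ⟨k, rfl⟩ := Nat.exists_eq_add_of_le (show o ≤ i by omega)
      exact hlt k (by omega)
    -- The gap just after the modified child is at or beyond the collapsed leaf, so its index is
    -- shifted by `m - 1`.
    have hsr : g' (o + (forestLeaves l + t'.numLeaves - 1)) =
        g (o + (forestLeaves l + t.numLeaves - 1)) := by
      rw [hge _ (by omega)]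
      congr 1
      omega
    constructor
    · rintro ⟨h, hz⟩
      obtain ⟨x, h0, hx⟩ := mono_node.1 h
      obtain ⟨h₁, h₂, h₃⟩ := forestMono_append.1 hx
      obtain ⟨h₄, h₅, h₆, h₇⟩ := forestMono_cons.1 h₃
      obtain ⟨h₄', hz'⟩ := IH.1 ⟨h₄, fun i hi hi' => by
        rw [add_assoc]; exact hz _ (by omega) (by omega)⟩
      refine ⟨mono_node.2 ⟨x, h0, forestMono_append.2 ⟨(hl x).1 h₁, fun i hi hl' _ => ?_,
        forestMono_cons.2 ⟨h₄', fun i hi hi' => ?_, fun i hi hr' => ?_, (hr x).1 h₇⟩⟩⟩, ?_⟩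
      · rw [← hsl i hi hl', h₂ i hi hl' (by simp)]
      · obtain ⟨k, rfl⟩ := Nat.exists_eq_add_of_le (show o ≤ i by omega)
        by_cases hk : k < forestLeaves l + a
        · rw [← hlt k hk]
          exact h₅ _ hi (by omega)
        by_cases hk' : k + 1 < forestLeaves l + a + m
        · rw [hz k (by omega) hk']
          exact h0
        · have := hge (k - (m - 1)) (by omega)
          rw [show o + (k - (m - 1)) + (m - 1) = o + k by omega] at this
          rw [← this]
          exact h₅ _ (by omega) (by omega)
      · rw [show i = o + (forestLeaves l + t.numLeaves - 1) by omega, ← hsr]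
        exact h₆ _ (by omega) hr'
      · rwa [← add_assoc]
    · rintro ⟨h, hz⟩
      obtain ⟨x, h0, hx⟩ := mono_node.1 h
      obtain ⟨h₁, h₂, h₃⟩ := forestMono_append.1 hx
      obtain ⟨h₄, h₅, h₆, h₇⟩ := forestMono_cons.1 h₃
      obtain ⟨h₄', hz'⟩ := IH.2 ⟨h₄, by rwa [add_assoc]⟩
      refine ⟨mono_node.2 ⟨x, h0, forestMono_append.2 ⟨(hl x).2 h₁, fun i hi hl' _ => ?_,
        forestMono_cons.2 ⟨h₄', fun i hi hi' => ?_, fun i hi hr' => ?_, (hr x).2 h₇⟩⟩⟩, ?_⟩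
      · rw [hsl i hi hl', h₂ i hi hl' (by simp)]
      · obtain ⟨k, rfl⟩ := Nat.exists_eq_add_of_le (show o ≤ i by omega)
        by_cases hk : k < forestLeaves l + a
        · rw [hlt k hk]
          exact h₅ _ hi (by omega)
        · rw [hge k (by omega)]
          exact h₅ _ (by omega) (by omega)
      · rw [show i = o + (forestLeaves l + t'.numLeaves - 1) by omega, hsr]
        exact h₆ _ (by omega) hr'
      · intro i hi hi'
        have := hz' (i - forestLeaves l) (by omega) (by omega)
        rwa [show o + forestLeaves l + (i - forestLeaves l) = o + i by omega] at this

theorem StrictlyBranching.eq_leaf {T : PlaneTree} (hT : T.StrictlyBranching)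
    (h : T.numLeaves ≤ 1) : T = PlaneTree.leaf := by
  cases hT with
  | leaf => rfl
  | node cs h₁ h₂ =>
    obtain ⟨j, hj, hj', -⟩ := exists_separator h₁ 0
    rw [numLeaves_node (by rintro rfl; simp at h₁)] at h
    omega

/-- A weakly monotone gap function is strictly monotone, or it is weakly monotone for a tree with
fewer internal vertices. -/
theorem Mono.strict_or_exists {T : PlaneTree} (hT : T.StrictlyBranching) {o : ℕ} {g : ℕ → ℝ}
    (h : Mono (· ≤ ·) T o g) : Mono (· < ·) T o g ∨
      (∃ T', ContractEdge T T' ∧ Mono (· ≤ ·) T' o g) ∨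
      ∃ a m T', CollapseVertex T a m T' ∧ g (o + a) = 0 := by
  induction T using induction_on_children generalizing o with
  | h cs ih =>
    obtain ⟨x, h0, hx⟩ := mono_node.1 h
    -- Strictness can fail below a vertex of value `x` in three ways: a contraction is possible
    -- inside a child, the root of a child also has the value `x`, or a collapse is possible inside
    -- a child.
    have forest : ∀ (ds : List PlaneTree) (o : ℕ),
        (∀ c ∈ ds, c ∈ cs) → ForestMono (· ≤ ·) x ds o g → ForestMono (· < ·) x ds o g ∨
        ∃ l c r, ds = l ++ c :: r ∧
          ((∃ c', ContractEdge c c' ∧ Mono (· ≤ ·) c' (o + forestLeaves l) g) ∨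
          (∃ cs', cs' ≠ [] ∧ c = node cs' ∧ ForestMono (· ≤ ·) x cs' (o + forestLeaves l) g) ∨
          ∃ a m c', CollapseVertex c a m c' ∧ g (o + forestLeaves l + a) = 0) := by
      intro ds
      induction ds with
      | nil => exact fun _ _ _ => Or.inl forestMono_nil
      | cons c ds ihd =>
        intro o hd hF
        obtain ⟨h₁, h₂, h₃, h₄⟩ := forestMono_cons.1 hF
        have hc : c ∈ cs := hd c (by simp)
        rcases ih c hc (hT.of_mem hc) h₁ with h₁' | ⟨c', hc', h'⟩ | ⟨a, m, c', hc', h'⟩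
        -- If some gap of `c` attains `x`, the value `y` of its root is squeezed: it is at least
        -- that gap and at most `x`. The edge to `c` can then be contracted.
        · by_cases hex : ∃ i, o ≤ i ∧ i + 1 < o + c.numLeaves ∧ g i = x
          · obtain ⟨i, hi, hi', hix⟩ := hex
            refine Or.inr ⟨[], c, ds, rfl, Or.inr (Or.inl ?_)⟩
            obtain ⟨cs'⟩ := c
            have hcs' : cs' ≠ [] := by
              rintro rfl
              have := numLeaves_leaf
              rw [leaf] at this
              omega
            obtain ⟨y, hy0, hy⟩ := mono_node.1 h₁
            refine ⟨cs', hcs', rfl, ?_⟩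
            rw [numLeaves_node hcs'] at hi' h₂
            have hxy : x ≤ y := by
              rcases hy.rel_or_eq hi hi' with h | h
              · exact hix ▸ h
              · exact (hix ▸ h).le
            obtain ⟨j, hj, hj', hsj⟩ :=
              exists_separator ((hT.of_mem hc).two_le_length hcs') o
            have hyx : y ≤ x := hsj _ _ _ hy ▸ h₂ j hj hj'
            rw [le_antisymm hxy hyx]
            exact hy
          · push Not at hex
            have h₂' : ∀ i, o ≤ i → i + 1 < o + c.numLeaves → g i < x := fun i hi hi' =>
              lt_of_le_of_ne (h₂ i hi hi') (hex i hi hi')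
            rcases ihd _ (fun e he => hd e (by simp [he])) h₄ with h | ⟨l, e, r, rfl, h⟩
            · exact Or.inl (forestMono_cons.2 ⟨h₁', h₂', h₃, h⟩)
            · refine Or.inr ⟨c :: l, e, r, rfl, ?_⟩
              rw [forestLeaves_cons, ← add_assoc]
              exact h
        · exact Or.inr ⟨[], c, ds, rfl, Or.inl ⟨c', hc', h'⟩⟩
        · exact Or.inr ⟨[], c, ds, rfl, Or.inr (Or.inr ⟨a, m, c', hc', h'⟩)⟩
    rcases forest cs o (fun c hc => hc) hx with hs | ⟨l, c, r, rfl, h | h | h⟩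
    · rcases h0.lt_or_eq with h0 | rfl
      · exact Or.inl (mono_node.2 ⟨x, h0, hs⟩)
      -- Now `x = 0`. On a leaf the value is a dummy and may be replaced by 1. Otherwise a gap
      -- inside a child would lie strictly between 0 and 0, so all children are leaves and the
      -- vertex collapses.
      by_cases hcs : cs = []
      · subst hcs
        exact Or.inl (mono_leaf ⟨1, one_pos⟩)
      refine Or.inr (Or.inr ⟨0, cs.length, leaf, ?_, ?_⟩)
      · have hl : ∀ c ∈ cs, c = leaf := by
          intro c hc
          refine (hT.of_mem hc).eq_leaf ?_
          obtain ⟨l, r, rfl⟩ := List.append_of_mem hc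
          obtain ⟨h₁, h₂, -, -⟩ := forestMono_cons.1 (forestMono_append.1 hs).2.2
          by_contra hn
          exact absurd (h₂ (o + forestLeaves l) le_rfl (by omega))
            (h₁.rel_zero le_rfl (by omega)).asymm
        have := CollapseVertex.root cs.length (by simpa using hcs)
        rwa [← List.eq_replicate_iff.2 ⟨rfl, hl⟩] at this
      · match cs, hT.two_le_length hcs with
        | c :: c' :: cs, _ =>
          obtain ⟨h₁, h₂, h₃, -⟩ := forestMono_cons.1 hs
          have hc : c.numLeaves = 1 := by
            have := c.numLeaves_pos
            by_contra hn
            exact absurd (h₂ o le_rfl (by omega)) (h₁.rel_zero le_rfl (by omega)).asymm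
          exact h₃ o (by omega) (by simp)
    · obtain ⟨c', hc', h⟩ := h
      refine Or.inr (Or.inl ⟨_, ContractEdge.child l r hc', mono_node.2 ⟨x, h0, ?_⟩⟩)
      obtain ⟨i, j, -, -, hg⟩ := hc'.exists_mono_iff (hT.of_mem (by simp)) (o + forestLeaves l)
      obtain ⟨h₁, h₂, h₃⟩ := forestMono_append.1 hx
      obtain ⟨h₄, h₅, h₆, h₇⟩ := forestMono_cons.1 h₃
      refine forestMono_append.2 ⟨h₁, fun i hi hl _ => h₂ i hi hl (by simp), ?_⟩
      refine forestMono_cons.2 ⟨h, ?_⟩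
      rw [hc'.numLeaves_eq]
      exact ⟨h₅, h₆, h₇⟩
    · obtain ⟨cs', hcs', rfl, hF⟩ := h
      refine Or.inr (Or.inl ⟨_, ContractEdge.root l r cs' hcs', mono_node.2 ⟨x, h0, ?_⟩⟩)
      obtain ⟨h₁, h₂, h₃⟩ := forestMono_append.1 hx
      obtain ⟨h₄, h₅, h₆, h₇⟩ := forestMono_cons.1 h₃
      rw [numLeaves_node hcs'] at h₅ h₆ h₇
      rw [List.append_assoc, forestMono_append, forestMono_append]
      exact ⟨h₁, fun i hi hl _ => h₂ i hi hl (by simp), hF, fun i hi _ hr => h₆ i hi hr, h₇⟩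
    · obtain ⟨a, m, c', hc', h⟩ := h
      exact Or.inr (Or.inr ⟨_, m, _, CollapseVertex.child l r hc', by rw [← add_assoc]; exact h⟩)

/-- Inside a child all gaps are strictly below `x`, so the gaps equal to `x` are exactly the
boundaries between children. Both lists are thus cut at the same places. -/
theorem ForestMono.eq_of_strict {x : ℝ} {cs cs' : List PlaneTree} {o : ℕ} {g : ℕ → ℝ}
    (ih : ∀ c ∈ cs, ∀ c' ∈ cs', ∀ o, c.numLeaves = c'.numLeaves → Mono (· < ·) c o g →
      Mono (· < ·) c' o g → c = c')
    (h : ForestMono (· < ·) x cs o g) (h' : ForestMono (· < ·) x cs' o g)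
    (hn : forestLeaves cs = forestLeaves cs') : cs = cs' := by
  induction cs generalizing cs' o with
  | nil =>
    by_contra hcs
    have := forestLeaves_pos (Ne.symm hcs)
    simp at hn
    omega
  | cons c cs ihc =>
    cases cs' with
    | nil =>
      have := forestLeaves_pos (List.cons_ne_nil c cs)
      rw [hn] at this
      simp at this
    | cons c' cs' =>
      obtain ⟨h₁, h₂, h₃, h₄⟩ := forestMono_cons.1 h
      obtain ⟨h₁', h₂', h₃', h₄'⟩ := forestMono_cons.1 h'
      have := c.numLeaves_pos
      have := c'.numLeaves_pos
      rw [forestLeaves_cons, forestLeaves_cons] at hn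
      have hc : c.numLeaves = c'.numLeaves := by
        rcases lt_trichotomy c.numLeaves c'.numLeaves with hlt | heq | hgt
        · have hne := h₃ (o + c.numLeaves - 1) (by omega) (by rintro rfl; simp at hn; omega)
          exact absurd hne (h₂' _ (by omega) (by omega)).ne
        · exact heq
        · have hne := h₃' (o + c'.numLeaves - 1) (by omega) (by rintro rfl; simp at hn; omega)
          exact absurd hne (h₂ _ (by omega) (by omega)).ne
      rw [ih c (by simp) c' (by simp) o hc h₁ h₁', ihc (cs' := cs') (fun d hd d' hd' => ih d (by simp [hd]) d'
        (by simp [hd'])) h₄ (by rwa [hc]) (by omega)]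

/-- A strictly branching tree is determined by a strictly monotone gap function. -/
theorem Mono.eq_of_strict {T T' : PlaneTree} (hT : T.StrictlyBranching)
    (hT' : T'.StrictlyBranching) {o : ℕ} {g : ℕ → ℝ} (hn : T.numLeaves = T'.numLeaves)
    (h : Mono (· < ·) T o g) (h' : Mono (· < ·) T' o g) : T = T' := by
  induction T using induction_on_children generalizing T' o with
  | h cs ih =>
    obtain ⟨cs'⟩ := T'
    by_cases hcs : cs = []
    · subst hcs
      refine (hT'.eq_leaf ?_).symm
      exact (hn.symm.trans numLeaves_leaf).le
    by_cases hcs' : cs' = []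
    · subst hcs'
      refine hT.eq_leaf ?_
      exact (hn.trans numLeaves_leaf).le
    rw [numLeaves_node hcs, numLeaves_node hcs'] at hn
    obtain ⟨x, h0, hx⟩ := mono_node.1 h
    obtain ⟨x', h0', hx'⟩ := mono_node.1 h'
    obtain ⟨i, hi, hi', hsi⟩ := exists_separator (hT.two_le_length hcs) o
    obtain ⟨j, hj, hj', hsj⟩ := exists_separator (hT'.two_le_length hcs') o
    have h₁ := hsi _ _ _ hx
    have h₂ := hsj _ _ _ hx'
    have h₃ := hx.rel_or_eq hj (by omega)
    have h₄ := hx'.rel_or_eq hi (by omega)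
    -- Both root values are the maximum of `g` over the gaps: each is attained, and each bounds the
    -- other.
    obtain rfl : x = x' := by
      rw [h₁] at h₄
      rw [h₂] at h₃
      rcases h₃ with h₃ | h₃
      · rcases h₄ with h₄ | h₄
        · exact absurd h₃ h₄.asymm
        · exact h₄
      · exact h₃.symm
    rw [ForestMono.eq_of_strict (fun c hc c' hc' o hn hm hm' =>
      ih c hc (hT.of_mem hc) (hT'.of_mem hc') hn hm hm') hx hx' hn]

/-- Values are assigned from the leaves upwards, each vertex exceeding everything below it. -/
theorem exists_strict (T : PlaneTree) : ∃ g, Mono (· < ·) T 0 g := by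
  induction T using induction_on_children with
  | h cs ih =>
    -- Every sufficiently large `x` must work, since all the siblings have to be served by the same
    -- `x`.
    have forest : ∃ B : ℝ, ∀ x, B < x → ∃ g, ForestMono (· < ·) x cs 0 g := by
      induction cs with
      | nil => exact ⟨0, fun x _ => ⟨fun _ => 0, forestMono_nil⟩⟩
      | cons c cs ihc =>
        obtain ⟨B, hB⟩ := ihc fun d hd => ih d (by simp [hd])
        obtain ⟨g, hg⟩ := ih c (by simp)
        obtain ⟨M, hM⟩ := ((Finset.range c.numLeaves).image g).exists_le
        refine ⟨max B M, fun x hx => ?_⟩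
        obtain ⟨g', hg'⟩ := hB x ((le_max_left _ _).trans_lt hx)
        -- Glue: the gaps of `c`, then the boundary gap with value `x`, then the shifted gaps of the
        -- remaining siblings.
        refine ⟨fun i => if i + 1 < c.numLeaves then g i else
          if i + 1 = c.numLeaves then x else g' (i - c.numLeaves),
          forestMono_cons.2 ⟨hg.congr fun i hi => ?_, fun i hi hi' => ?_, fun i hi hi' => ?_,
            hg'.congr fun i hi => ?_⟩⟩
        · simp [hi]
        · rw [zero_add] at hi'
          simp only [hi', if_true]
          exact (hM _ (Finset.mem_image_of_mem _ (Finset.mem_range.2 (by omega)))).trans_lt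
            ((le_max_right _ _).trans_lt hx)
        · simp [show i + 1 = c.numLeaves by omega]
        · simp only [zero_add, add_tsub_cancel_left]
          rw [if_neg (by omega), if_neg (by omega)]
    obtain ⟨B, hB⟩ := forest
    obtain ⟨g, hg⟩ := hB (max B 0 + 1) (by linarith [le_max_left B 0])
    exact ⟨g, mono_node.2 ⟨_, by linarith [le_max_right B 0], hg⟩⟩

end PlaneTree
end PermutoAssoc

-- Addresses of gaps, and monotonicity in terms of ancestors.

namespace PermutoAssoc
namespace PlaneTree

mutual
/-- The closest common ancestor of the `i`-th and the `(i+1)`-st leaf, counted from `0`. -/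
def gapPath : PlaneTree → ℕ → List ℕ
  | node cs, i => forestGapPath 0 cs i
/-- The version of `gapPath` for a list of siblings the first of which is at position `p`. -/
def forestGapPath : ℕ → List PlaneTree → ℕ → List ℕ
  | _, [], _ => []
  | p, c :: cs, i =>
    if i + 1 < c.numLeaves then p :: gapPath c i
    else if i + 1 = c.numLeaves then []
    else forestGapPath (p + 1) cs (i - c.numLeaves)
end

theorem commonAncestor_nil (u : List ℕ) : commonAncestor u [] = [] := by
  cases u <;> simp [commonAncestor]

theorem exists_of_mem_forestLeafPaths {p : ℕ} {cs : List PlaneTree} {v : List ℕ}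
    (h : v ∈ forestLeafPaths p cs) : ∃ q u, p ≤ q ∧ v = q :: u := by
  induction cs generalizing p with
  | nil => simp [forestLeafPaths] at h
  | cons c cs ih =>
    rw [forestLeafPaths, List.mem_append, List.mem_map] at h
    rcases h with ⟨u, -, rfl⟩ | h
    · exact ⟨p, u, le_rfl, rfl⟩
    · obtain ⟨q, u, hq, rfl⟩ := ih h
      exact ⟨q, u, by omega, rfl⟩

/-- No bound on `i` is needed: an absent leaf has the default address `[]`, whose common prefix with
anything is `[]`, and this agrees with `gapPath` out of range. -/
theorem commonAncestor_leafPaths (T : PlaneTree) (i : ℕ) :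
    commonAncestor (T.leafPaths.getD i []) (T.leafPaths.getD (i + 1) []) = T.gapPath i := by
  induction T using induction_on_children generalizing i with
  | h cs ih =>
    have forest : ∀ p i, commonAncestor ((forestLeafPaths p cs).getD i [])
        ((forestLeafPaths p cs).getD (i + 1) []) = forestGapPath p cs i := by
      induction cs with
      | nil => simp [forestLeafPaths, forestGapPath, commonAncestor_nil]
      | cons c cs ihc =>
        intro p i
        have hc := ih c (by simp) i
        have hcs := ihc (fun d hd => ih d (by simp [hd])) (p + 1) (i - c.numLeaves)
        have hlen : (c.leafPaths.map (fun v => p :: v)).length = c.numLeaves := by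
          rw [List.length_map, numLeaves]
        have hmap : ∀ j < c.numLeaves, (c.leafPaths.map (fun v => p :: v)).getD j [] =
            p :: c.leafPaths.getD j [] := by
          intro j hj
          rw [numLeaves] at hj
          simp [hj]
        rw [forestLeafPaths, forestGapPath]
        split_ifs with h₁ h₂
        · rw [List.getD_append _ _ _ _ (by omega), List.getD_append _ _ _ _ (by omega),
            hmap _ (by omega), hmap _ h₁, commonAncestor, if_pos rfl, hc]
        · rw [List.getD_append _ _ _ _ (by omega), List.getD_append_right _ _ _ _ (by omega),
            hmap _ (by omega), List.getD_eq_getElem?_getD, List.getD_eq_getElem?_getD]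
          -- The next leaf is absent or belongs to a later sibling; in the latter case the addresses
          -- differ in their first entry.
          cases hv : (forestLeafPaths (p + 1) cs)[i + 1 -
              (c.leafPaths.map (fun v => p :: v)).length]? with
          | none => exact commonAncestor_nil _
          | some v =>
            obtain ⟨q, u, hq, rfl⟩ := exists_of_mem_forestLeafPaths (List.mem_of_getElem? hv)
            rw [Option.getD_some, commonAncestor, if_neg (by omega)]
        · rw [List.getD_append_right _ _ _ _ (by omega),
            List.getD_append_right _ _ _ _ (by omega), hlen, ← hcs,
            show i + 1 - c.numLeaves = i - c.numLeaves + 1 by omega]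
    rw [gapPath, ← forest]
    cases cs with
    | nil => simp [leafPaths, forestLeafPaths, commonAncestor_nil]
    | cons c cs => rw [leafPaths]

theorem labeledVertex_succ (T : PlaneTree) (i : ℕ) : T.labeledVertex (i + 1) = T.gapPath i := by
  rw [labeledVertex, leafAt, leafAt, ← commonAncestor_leafPaths]
  rfl

theorem forestGapPath_eq_nil_or (p : ℕ) (cs : List PlaneTree) (i : ℕ) :
    forestGapPath p cs i = [] ∨ ∃ q u, p ≤ q ∧ forestGapPath p cs i = q :: u := by
  induction cs generalizing p i with
  | nil => simp [forestGapPath]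
  | cons c cs ih =>
    rw [forestGapPath]
    split_ifs with h₁ h₂
    · exact Or.inr ⟨p, _, le_rfl, rfl⟩
    · exact Or.inl rfl
    · rcases ih (p + 1) (i - c.numLeaves) with h | ⟨q, u, hq, h⟩
      · exact Or.inl h
      · exact Or.inr ⟨q, u, by omega, h⟩

/-- Links the recursive condition to the ancestor order. Addresses in different children are
incomparable, and equal addresses are prefixes of each other, which forces equal values. Strict
branching ensures that every internal vertex owns a gap, so its value can be read off from `g`. -/
theorem mono_iff_gapPath {T : PlaneTree} (hT : T.StrictlyBranching) {o : ℕ} {g : ℕ → ℝ} :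
    Mono (· ≤ ·) T o g ↔ (∀ i, i + 1 < T.numLeaves → 0 ≤ g (o + i)) ∧
      ∀ i j, i + 1 < T.numLeaves → j + 1 < T.numLeaves → T.gapPath j <+: T.gapPath i →
        g (o + i) ≤ g (o + j) := by
  induction T using induction_on_children generalizing o with
  | h cs ih =>
    -- The empty address is the parent itself, so comparisons with it become bounds by `x`; only
    -- nonempty addresses are compared with each other.
    have forest : ∀ x, 0 ≤ x → ∀ (ds : List PlaneTree) (p o : ℕ), (∀ c ∈ ds, c ∈ cs) →
        (ForestMono (· ≤ ·) x ds o g ↔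
          (∀ i, i + 1 < forestLeaves ds → 0 ≤ g (o + i) ∧ g (o + i) ≤ x ∧
            (forestGapPath p ds i = [] → g (o + i) = x)) ∧
          ∀ i j, i + 1 < forestLeaves ds → j + 1 < forestLeaves ds →
            forestGapPath p ds j ≠ [] → forestGapPath p ds j <+: forestGapPath p ds i →
            g (o + i) ≤ g (o + j)) := by
      intro x h0 ds
      induction ds with
      | nil => simp [forestMono_nil]
      | cons c ds ihd =>
        intro p o hd
        have hc : c ∈ cs := hd c (by simp)
        have hpos := c.numLeaves_pos
        rw [forestMono_cons, ih c hc (hT.of_mem hc), ihd (p + 1) _ fun d h => hd d (by simp [h]),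
          forestLeaves_cons]
        have e₁ : ∀ i, i + 1 < c.numLeaves → forestGapPath p (c :: ds) i = p :: c.gapPath i := by
          intro i hi
          rw [forestGapPath, if_pos hi]
        have e₂ : ∀ i, i + 1 = c.numLeaves → forestGapPath p (c :: ds) i = [] := by
          intro i hi
          rw [forestGapPath, if_neg (by omega), if_pos hi]
        have e₃ : ∀ i, forestGapPath p (c :: ds) (c.numLeaves + i) =
            forestGapPath (p + 1) ds i := by
          intro i
          rw [forestGapPath, if_neg (by omega), if_neg (by omega), add_tsub_cancel_left]
        constructor
        · rintro ⟨⟨h₁, h₁'⟩, h₂, h₃, h₄, h₅⟩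
          constructor
          · intro i hi
            rcases lt_trichotomy (i + 1) c.numLeaves with hlt | heq | hgt
            · exact ⟨h₁ i hlt, h₂ _ (by omega) (by omega), fun h => by simp [e₁ i hlt] at h⟩
            · have hx := h₃ (o + i) (by omega) (by rintro rfl; simp at hi; omega)
              exact ⟨hx ▸ h0, hx.le, fun _ => hx⟩
            · obtain ⟨k, rfl⟩ := Nat.exists_eq_add_of_le (show c.numLeaves ≤ i by omega)
              rw [e₃, ← add_assoc]
              exact h₄ k (by omega)
          · intro i j hi hj hne hp
            rcases lt_trichotomy (j + 1) c.numLeaves with hlt | heq | hgt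
            · rw [e₁ j hlt] at hp
              rcases lt_trichotomy (i + 1) c.numLeaves with hlt' | heq' | hgt'
              · rw [e₁ i hlt', List.cons_prefix_cons] at hp
                exact h₁' i j hlt' hlt hp.2
              · rw [e₂ i heq'] at hp
                simp at hp
              · obtain ⟨k, rfl⟩ := Nat.exists_eq_add_of_le (show c.numLeaves ≤ i by omega)
                rw [e₃] at hp
                rcases forestGapPath_eq_nil_or (p + 1) ds k with h | ⟨q, u, hq, h⟩
                · rw [h] at hp
                  simp at hp
                · rw [h, List.cons_prefix_cons] at hp
                  omega
            · exact absurd (e₂ j heq) hne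
            · obtain ⟨k, rfl⟩ := Nat.exists_eq_add_of_le (show c.numLeaves ≤ j by omega)
              rw [e₃] at hp hne
              obtain ⟨q, u, hq, h⟩ := (forestGapPath_eq_nil_or (p + 1) ds k).resolve_left hne
              rcases lt_trichotomy (i + 1) c.numLeaves with hlt' | heq' | hgt'
              · rw [e₁ i hlt', h, List.cons_prefix_cons] at hp
                omega
              · rw [e₂ i heq', h] at hp
                simp at hp
              · obtain ⟨l, rfl⟩ := Nat.exists_eq_add_of_le (show c.numLeaves ≤ i by omega)
                rw [e₃] at hp
                rw [← add_assoc, ← add_assoc]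
                exact h₅ l k (by omega) (by omega) hne hp
        · rintro ⟨h₁, h₂⟩
          refine ⟨⟨fun i hi => (h₁ i (by omega)).1, fun i j hi hj hp => ?_⟩, fun i hi hi' => ?_,
            fun i hi hds => ?_, fun i hi => ?_, fun i j hi hj hne hp => ?_⟩
          · refine h₂ i j (by omega) (by omega) (by simp [e₁ j hj]) ?_
            rw [e₁ i hi, e₁ j hj, List.cons_prefix_cons]
            exact ⟨rfl, hp⟩
          · obtain ⟨k, rfl⟩ := Nat.exists_eq_add_of_le hi
            exact (h₁ k (by omega)).2.1
          · have := forestLeaves_pos hds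
            obtain ⟨k, rfl⟩ := Nat.exists_eq_add_of_le (show o ≤ i by omega)
            exact (h₁ k (by omega)).2.2 (e₂ k (by omega))
          · rw [← e₃, add_assoc]
            exact h₁ _ (by omega)
          · rw [← e₃] at hne hp
            rw [← e₃ i] at hp
            rw [add_assoc, add_assoc]
            exact h₂ _ _ (by omega) (by omega) hne hp
    rw [mono_node]
    by_cases hcs : cs = []
    · subst hcs
      have : (node []).numLeaves = 1 := numLeaves_leaf
      simp only [this, forestMono_nil, and_true]
      exact ⟨fun _ => ⟨fun i hi => by omega, fun i j hi => by omega⟩, fun _ => ⟨0, le_rfl⟩⟩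
    rw [numLeaves_node hcs]
    constructor
    · rintro ⟨x, h0, hx⟩
      obtain ⟨h₁, h₂⟩ := (forest x h0 cs 0 o fun c hc => hc).1 hx
      refine ⟨fun i hi => (h₁ i hi).1, fun i j hi hj hp => ?_⟩
      rw [gapPath, gapPath] at hp
      by_cases hj' : forestGapPath 0 cs j = []
      · rw [(h₁ j hj).2.2 hj']
        exact (h₁ i hi).2.1
      · exact h₂ i j hi hj hj' hp
    · rintro ⟨h₁, h₂⟩
      simp only [gapPath] at h₂
      have hsep : ∃ s, s + 1 < forestLeaves cs ∧ forestGapPath 0 cs s = [] := by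
        match cs, hT.two_le_length hcs with
        | c :: c' :: cs, _ =>
          have := c.numLeaves_pos
          have := c'.numLeaves_pos
          refine ⟨c.numLeaves - 1, by simp; omega, ?_⟩
          rw [forestGapPath, if_neg (by omega), if_pos (by omega)]
      obtain ⟨s, hs, hs'⟩ := hsep
      refine ⟨g (o + s), h₁ s hs, (forest _ (h₁ s hs) cs 0 o fun c hc => hc).2
        ⟨fun i hi => ⟨h₁ i hi, h₂ i s hi hs (by simp [hs']), fun hi' => ?_⟩,
          fun i j hi hj _ hp => h₂ i j hi hj hp⟩⟩
      exact le_antisymm (h₂ i s hi hs (by simp [hs'])) (h₂ s i hs hi (by simp [hi']))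

end PlaneTree
end PermutoAssoc

-- Types, block indices and preorders of ordered partitions.

namespace PermutoAssoc
namespace OrderedPartition

variable {n : ℕ} {S : OrderedPartition n}

theorem typeAt_zero (S : OrderedPartition n) : S.typeAt 0 = 0 := by simp [typeAt]

theorem typeAt_succ {i : ℕ} (hi : i < S.blocks.length) :
    S.typeAt (i + 1) = S.typeAt i + (S.blocks[i]).card := by
  rw [typeAt, typeAt, ← List.take_append_getElem hi, List.map_append, List.sum_append]
  simp

theorem typeAt_lt_typeAt {i j : ℕ} (hij : i < j) (hj : j ≤ S.blocks.length) :
    S.typeAt i < S.typeAt j := by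
  induction j, hij using Nat.le_induction with
  | base =>
    rw [typeAt_succ (by omega)]
    have := (S.nonempty _ (List.getElem_mem (show i < S.blocks.length by omega))).card_pos
    omega
  | succ j hij ih =>
    rw [typeAt_succ (by omega)]
    have := ih (by omega)
    omega

theorem typeAt_inj {i j : ℕ} (hi : i ≤ S.blocks.length) (hj : j ≤ S.blocks.length)
    (h : S.typeAt i = S.typeAt j) : i = j := by
  rcases lt_trichotomy i j with hij | hij | hij
  · exact absurd h (typeAt_lt_typeAt hij hj).ne
  · exact hij
  · exact absurd h (typeAt_lt_typeAt hij hi).ne'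

variable {f : Fin n → Fin S.blocks.length}

theorem card_index_lt (hf : ∀ x a, x ∈ S.blocks.get a ↔ f x = a) {b : ℕ}
    (hb : b ≤ S.blocks.length) :
    (Finset.univ.filter fun x => (f x).val < b).card = S.typeAt b := by
  induction b with
  | zero => simp [typeAt_zero]
  | succ b ih =>
    rw [typeAt_succ (by omega), ← ih (by omega), ← Finset.card_union_of_disjoint]
    · congr 1
      ext x
      have := hf x ⟨b, by omega⟩
      simp only [List.get_eq_getElem] at this
      simp only [Finset.mem_filter, Finset.mem_univ, true_and, Finset.mem_union, this, Fin.ext_iff]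
      omega
    · rw [Finset.disjoint_left]
      intro x hx hx'
      have := hf x ⟨b, by omega⟩
      simp only [List.get_eq_getElem] at this
      rw [this] at hx'
      simp [hx'] at hx

theorem typeAt_length (S : OrderedPartition n) : S.typeAt S.blocks.length = n := by
  obtain ⟨f, hf⟩ := S.exists_index
  rw [← card_index_lt hf le_rfl]
  simp

/-- By monotonicity the positions with block index below `b` form an initial segment, and its length
is their number, `S.typeAt b`. -/
theorem index_lt_iff (hf : ∀ x a, x ∈ S.blocks.get a ↔ f x = a) {π : Equiv.Perm (Fin n)}
    (hπ : Monotone (f ∘ π.symm)) {b : ℕ} (hb : b ≤ S.blocks.length) (a : Fin n) :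
    (f (π.symm a)).val < b ↔ a.val < S.typeAt b := by
  have hcard : (Finset.univ.filter fun a => (f (π.symm a)).val < b).card = S.typeAt b := by
    rw [← card_index_lt hf hb]
    exact Finset.card_equiv π.symm (by simp)
  rw [← hcard]
  constructor
  · intro h
    have : Finset.Iic a ⊆ Finset.univ.filter fun a => (f (π.symm a)).val < b := by
      intro c hc
      simp only [Finset.mem_filter, Finset.mem_univ, true_and]
      exact lt_of_le_of_lt (hπ (Finset.mem_Iic.1 hc)) h
    have := Finset.card_le_card this
    rw [Fin.card_Iic] at this
    omega
  · contrapose!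
    intro h
    have : (Finset.univ.filter fun a => (f (π.symm a)).val < b) ⊆ Finset.Iio a := by
      intro c hc
      simp only [Finset.mem_filter, Finset.mem_univ, true_and] at hc
      rw [Finset.mem_Iio]
      by_contra hac
      have h' : (f (π.symm a)).val ≤ (f (π.symm c)).val := hπ (not_lt.1 hac)
      omega
    have := Finset.card_le_card this
    rwa [Fin.card_Iio] at this

theorem le_iff_index (hf : ∀ x a, x ∈ S.blocks.get a ↔ f x = a) {x y : Fin n} :
    S.Le x y ↔ f x ≤ f y := by
  constructor
  · rintro ⟨a, b, hab, hx, hy⟩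
    rwa [(hf x a).1 hx, (hf y b).1 hy]
  · exact fun h => ⟨f x, f y, h, (hf _ _).2 rfl, (hf _ _).2 rfl⟩

theorem equiv_iff_index (hf : ∀ x a, x ∈ S.blocks.get a ↔ f x = a) {x y : Fin n} :
    S.Equiv x y ↔ f x = f y := by
  rw [Equiv, le_iff_index hf, le_iff_index hf, le_antisymm_iff]

theorem mem_blocks_iff {B : Finset (Fin n)} :
    B ∈ S.blocks ↔ ∃ x, ∀ y, y ∈ B ↔ S.Equiv x y := by
  obtain ⟨f, hf⟩ := S.exists_index
  constructor
  · intro hB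
    obtain ⟨x, hx⟩ := S.nonempty B hB
    obtain ⟨a, rfl⟩ := List.get_of_mem hB
    refine ⟨x, fun y => ?_⟩
    rw [equiv_iff_index hf, (hf x a).1 hx, hf, eq_comm]
  · rintro ⟨x, hx⟩
    have : B = S.blocks.get (f x) := by
      ext y
      rw [hx, equiv_iff_index hf, hf, eq_comm]
    exact this ▸ List.get_mem _ _

theorem nodup_blocks (S : OrderedPartition n) : S.blocks.Nodup := by
  refine S.disjoint.imp_of_mem fun {A B} hA _ h hAB => ?_
  subst hAB
  exact (S.nonempty A hA).ne_empty (Finset.disjoint_self_iff_empty _ |>.1 h)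

/-- An ordered partition is determined by its preorder. -/
theorem eq_of_le_iff {S S' : OrderedPartition n} (h : ∀ x y, S.Le x y ↔ S'.Le x y) : S = S' := by
  have hmem : ∀ B, B ∈ S.blocks ↔ B ∈ S'.blocks := by
    intro B
    simp only [mem_blocks_iff, Equiv, h]
  have hperm : S.blocks.Perm S'.blocks :=
    (List.perm_ext_iff_of_nodup S.nodup_blocks S'.nodup_blocks).2 hmem
  -- Both lists have the same members; it remains to see that the preorder also fixes their order.
  have hsort : ∀ S : OrderedPartition n,
      S.blocks.Pairwise fun A B => ∃ x ∈ A, ∃ y ∈ B, ¬ S.Le y x := by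
    intro S
    obtain ⟨f, hf⟩ := S.exists_index
    rw [List.pairwise_iff_getElem]
    intro i j hi hj hij
    obtain ⟨x, hx⟩ := S.nonempty _ (List.getElem_mem hi)
    obtain ⟨y, hy⟩ := S.nonempty _ (List.getElem_mem hj)
    refine ⟨x, hx, y, hy, ?_⟩
    rw [le_iff_index hf, (hf x ⟨i, hi⟩).1 hx, (hf y ⟨j, hj⟩).1 hy]
    simpa using hij
  have hsort' := hsort S'
  simp only [← h] at hsort'
  have hb : S.blocks = S'.blocks := by
    refine hperm.eq_of_pairwise ?_ (hsort S) hsort'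
    rintro A B hA hB ⟨x, hx, y, hy, hxy⟩ ⟨y', hy', x', hx', hyx⟩
    exfalso
    obtain ⟨f, hf⟩ := S.exists_index
    obtain ⟨a, rfl⟩ := List.get_of_mem hA
    obtain ⟨b, rfl⟩ := List.get_of_mem ((hmem B).2 hB)
    rw [le_iff_index hf] at hxy hyx
    rw [hf] at hx hy hx' hy'
    rw [hx, hy] at hxy
    rw [hx', hy'] at hyx
    exact hxy (not_le.1 hyx).le
  cases S
  cases S'
  simpa using hb

/-! ### Merging consecutive blocks -/

theorem mem_foldr_union {L : List (Finset (Fin n))} {x : Fin n} :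
    x ∈ L.foldr (· ∪ ·) ∅ ↔ ∃ B ∈ L, x ∈ B := by
  induction L with
  | nil => simp
  | cons B L ih => simp [ih]

theorem card_foldr_union {L : List (Finset (Fin n))} (h : L.Pairwise Disjoint) :
    (L.foldr (· ∪ ·) ∅).card = (L.map Finset.card).sum := by
  induction L with
  | nil => simp
  | cons B L ih =>
    rw [List.pairwise_cons] at h
    rw [List.foldr_cons, Finset.card_union_of_disjoint, ih h.2, List.map_cons, List.sum_cons]
    rw [Finset.disjoint_left]
    intro x hx hx'
    obtain ⟨C, hC, hxC⟩ := mem_foldr_union.1 hx'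
    exact Finset.disjoint_left.1 (h.1 C hC) hx hxC

theorem exists_split {α : Type*} (L : List α) {a m : ℕ} (h : a + m ≤ L.length) :
    ∃ A M C, L = A ++ M ++ C ∧ A.length = a ∧ M.length = m ∧ L.take a = A ∧
      (L.drop a).take m = M ∧ L.drop (a + m) = C := by
  refine ⟨L.take a, (L.drop a).take m, L.drop (a + m), ?_, ?_, ?_, rfl, rfl, rfl⟩
  · rw [List.append_assoc, ← List.drop_drop, List.take_append_drop, List.take_append_drop]
  · simp; omega
  · simp; omega

theorem exists_merge (S : OrderedPartition n) {a m : ℕ} (hm : m ≠ 0)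
    (h : a + m ≤ S.blocks.length) : ∃ S' : OrderedPartition n,
      S'.blocks = S.blocks.take a ++
        ((S.blocks.drop a).take m).foldr (· ∪ ·) ∅ :: S.blocks.drop (a + m) := by
  obtain ⟨A, M, C, hL, hA, hM, h₁, h₂, h₃⟩ := exists_split S.blocks h
  rw [h₁, h₂, h₃]
  have hne := S.nonempty
  have hdis := S.disjoint
  have hcov := S.cover
  rw [hL] at hne hdis hcov
  simp only [List.pairwise_append] at hdis
  obtain ⟨⟨hdA, hdM, hAM⟩, hdC, hAC⟩ := hdis
  refine ⟨⟨A ++ M.foldr (· ∪ ·) ∅ :: C, ?_, ?_, ?_⟩, rfl⟩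
  · intro B hB
    rcases List.mem_append.1 hB with hB | hB
    · exact hne B (by simp [hB])
    · rcases List.mem_cons.1 hB with rfl | hB
      · have hM0 : M ≠ [] := by
          rintro rfl
          exact hm hM.symm
        obtain ⟨B, hB⟩ := List.exists_mem_of_ne_nil M hM0
        obtain ⟨x, hx⟩ := hne B (by simp [hB])
        exact ⟨x, mem_foldr_union.2 ⟨B, hB, hx⟩⟩
      · exact hne B (by simp [hB])
  · rw [List.pairwise_append, List.pairwise_cons]
    refine ⟨hdA, ⟨fun B hB => ?_, hdC⟩, fun B hB B' hB' => ?_⟩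
    · rw [Finset.disjoint_left]
      intro x hx hx'
      obtain ⟨D, hD, hxD⟩ := mem_foldr_union.1 hx
      exact Finset.disjoint_left.1 (hAC D (by simp [hD]) B hB) hxD hx'
    · rcases List.mem_cons.1 hB' with rfl | hB'
      · rw [Finset.disjoint_left]
        intro x hx hx'
        obtain ⟨D, hD, hxD⟩ := mem_foldr_union.1 hx'
        exact Finset.disjoint_left.1 (hAM B hB D hD) hx hxD
      · exact hAC B (by simp [hB]) B' hB'
  · intro x
    obtain ⟨B, hB, hx⟩ := hcov x
    simp only [List.mem_append] at hB
    rcases hB with (hB | hB) | hB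
    · exact ⟨B, by simp [hB], hx⟩
    · exact ⟨_, by simp, mem_foldr_union.2 ⟨B, hB, hx⟩⟩
    · exact ⟨B, by simp [hB], hx⟩

variable {S' : OrderedPartition n} {a m : ℕ}

theorem typeAt_merge_of_le (h : a + m ≤ S.blocks.length)
    (hS' : S'.blocks = S.blocks.take a ++
      ((S.blocks.drop a).take m).foldr (· ∪ ·) ∅ :: S.blocks.drop (a + m))
    {i : ℕ} (hi : i ≤ a) : S'.typeAt i = S.typeAt i := by
  obtain ⟨A, M, C, hL, hA, hM, h₁, h₂, h₃⟩ := exists_split S.blocks h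
  rw [h₁, h₂, h₃] at hS'
  rw [typeAt, typeAt, hS', hL, List.append_assoc, List.take_append_of_le_length (by omega),
    List.take_append_of_le_length (by omega)]

/-- Replacing `m` blocks by their union keeps the total size but shortens the list by `m - 1`. -/
theorem typeAt_merge_of_gt (h : a + m ≤ S.blocks.length) (hm : m ≠ 0)
    (hS' : S'.blocks = S.blocks.take a ++
      ((S.blocks.drop a).take m).foldr (· ∪ ·) ∅ :: S.blocks.drop (a + m))
    {i : ℕ} (hi : a < i) : S'.typeAt i = S.typeAt (i + (m - 1)) := by
  obtain ⟨A, M, C, hL, hA, hM, h₁, h₂, h₃⟩ := exists_split S.blocks h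
  have hdis := S.disjoint
  rw [h₁, h₂, h₃] at hS'
  rw [hL] at hdis
  simp only [List.pairwise_append] at hdis
  obtain ⟨j, rfl⟩ := Nat.exists_eq_add_of_lt hi
  have e₁ : a + j + 1 = A.length + (j + 1) := by omega
  have e₂ : a + j + 1 + (m - 1) = (A ++ M).length + j := by
    rw [List.length_append]
    omega
  rw [typeAt, typeAt, hS', hL, e₂, e₁, List.take_length_add_append, List.take_length_add_append]
  simp [card_foldr_union hdis.1.2.1]

/-- Lets one permutation serve both partitions of a collapse step. -/
theorem refines_merge (h : a + m ≤ S.blocks.length) (hm : m ≠ 0)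
    (hS' : S'.blocks = S.blocks.take a ++
      ((S.blocks.drop a).take m).foldr (· ∪ ·) ∅ :: S.blocks.drop (a + m)) :
    S.Refines S' := by
  have hlen : S'.blocks.length + m = S.blocks.length + 1 := by
    rw [hS']
    simp
    omega
  refine ⟨fun i => ⟨if i.val < a then i else if i.val < a + m then a else i - (m - 1), ?_⟩,
    fun i j hij => ?_, fun i x hx => ?_⟩
  · have := i.2
    split_ifs <;> omega
  · rw [Fin.le_def] at hij ⊢
    dsimp only
    split_ifs <;> omega
  · have hi := i.2
    simp only [List.get_eq_getElem, hS'] at hx ⊢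
    split_ifs with h₁ h₂
    · rw [List.getElem_append_left (by simp; omega), List.getElem_take]
      exact hx
    · rw [List.getElem_append_right (by simp)]
      simp only [List.length_take, min_eq_left (show a ≤ S.blocks.length by omega), tsub_self,
        List.getElem_cons_zero]
      refine mem_foldr_union.2 ⟨_, ?_, hx⟩
      rw [List.mem_iff_getElem]
      refine ⟨i - a, by simp; omega, ?_⟩
      rw [List.getElem_take, List.getElem_drop]
      congr 1
      omega
    · rw [List.getElem_append_right (by simp; omega), List.getElem_cons, dif_neg (by simp; omega),
        List.getElem_drop]
      convert hx using 2
      simp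
      omega

theorem Refines.trans {S₁ S₂ S₃ : OrderedPartition n} (h : S₁.Refines S₂) (h' : S₂.Refines S₃) :
    S₁.Refines S₃ := by
  obtain ⟨f, hf, hs⟩ := h
  obtain ⟨g, hg, ht⟩ := h'
  exact ⟨g ∘ f, hg.comp hf, fun a => (hs a).trans (ht _)⟩

end OrderedPartition
end PermutoAssoc

namespace PermutoAssoc

variable {d : ℕ}

/-! ### Gap coordinates -/

theorem coordDiff_mk (x y : Fin (d + 1)) (v : Fin (d + 1) → ℝ) :
    coordDiff x y (Submodule.Quotient.mk v) = v x - v y := by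
  simp [coordDiff]

theorem coordDiff_self (x : Fin (d + 1)) (w : W d) : coordDiff x x w = 0 := by
  induction w using Submodule.Quotient.induction_on with
  | H v => rw [coordDiff_mk, sub_self]

theorem coordDiff_add (x y z : Fin (d + 1)) (w : W d) :
    coordDiff x y w + coordDiff y z w = coordDiff x z w := by
  induction w using Submodule.Quotient.induction_on with
  | H v => simp only [coordDiff_mk, sub_add_sub_cancel]

theorem coordDiff_swap (x y : Fin (d + 1)) (w : W d) : coordDiff y x w = - coordDiff x y w := by
  induction w using Submodule.Quotient.induction_on with
  | H v => simp only [coordDiff_mk, neg_sub]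

/-- Telescoping sum of gaps. The submonoid `K` is `⊥` when the gaps vanish, and the nonnegative
reals when they have a sign. -/
theorem coordDiff_mem (K : AddSubmonoid ℝ) (π : Equiv.Perm (Fin (d + 1))) {w : W d}
    {a b : Fin (d + 1)} (hab : a ≤ b)
    (h : ∀ l : Fin d, a ≤ l.castSucc → l.succ ≤ b → D π l w ∈ K) :
    coordDiff (π.symm b) (π.symm a) w ∈ K := by
  induction b using Fin.induction with
  | zero =>
    obtain rfl : a = 0 := le_antisymm hab (Fin.zero_le _)
    rw [coordDiff_self]
    exact K.zero_mem
  | succ l ih =>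
    rcases hab.lt_or_eq with hlt | rfl
    · have hal : a ≤ l.castSucc := Fin.le_castSucc_iff.2 hlt
      rw [← coordDiff_add _ (π.symm l.castSucc)]
      exact K.add_mem (h l hal le_rfl)
        (ih hal fun k hk hk' => h k hk (hk'.trans (Fin.castSucc_le_succ l)))
    · rw [coordDiff_self]
      exact K.zero_mem

/-- The gap `D^π_p w` for a natural number `1 ≤ p ≤ d`. -/
def gap (π : Equiv.Perm (Fin (d + 1))) (p : ℕ) : W d →ₗ[ℝ] ℝ :=
  if h : p - 1 < d then D π ⟨p - 1, h⟩ else 0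

theorem gap_succ (π : Equiv.Perm (Fin (d + 1))) (l : Fin d) : gap π (l + 1) = D π l := by
  simp [gap]

theorem exists_gap_eq (G : ℕ → ℝ) (π : Equiv.Perm (Fin (d + 1))) :
    ∃ w : W d, ∀ l : Fin d, D π l w = G (l + 1) := by
  refine ⟨Submodule.Quotient.mk fun x => ∑ p ∈ Finset.range (π x), G (p + 1), fun l => ?_⟩
  rw [D, coordDiff_mk]
  simp [Finset.sum_range_succ]

/-- Positions `l` and `l + 1` (counted from 1) lie in the same block unless `l` is in the type;
within a block the gaps telescope. -/
theorem mem_WS_iff {S : OrderedPartition (d + 1)} {π : Equiv.Perm (Fin (d + 1))}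
    (hπ : (OrderedPartition.ofPerm π).Refines S) {w : W d} :
    w ∈ WS S ↔ ∀ l : Fin d,
      (¬ ∃ i, 1 ≤ i ∧ i < S.blocks.length ∧ l.val + 1 = S.typeAt i) → D π l w = 0 := by
  obtain ⟨f, hf⟩ := S.exists_index
  have hmono := (S.refines_ofPerm_iff hf π).1 hπ
  constructor
  · intro hw l hl
    refine hw _ _ ((OrderedPartition.equiv_iff_index hf).2 (le_antisymm ?_ ?_))
    · by_contra hlt
      rw [not_le] at hlt
      have h₁ := (OrderedPartition.index_lt_iff hf hmono (f (π.symm l.succ)).2.le l.castSucc).1 hlt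
      have h₂ := (OrderedPartition.index_lt_iff hf hmono (f (π.symm l.succ)).2.le l.succ).not.1
        (lt_irrefl _)
      have h₃ : (f (π.symm l.castSucc)).val < (f (π.symm l.succ)).val := hlt
      simp only [Fin.val_castSucc, Fin.val_succ] at h₁ h₂
      exact hl ⟨_, by omega, (f (π.symm l.succ)).2, by omega⟩
    · exact hmono (Fin.castSucc_le_succ l)
  · intro h
    have key : ∀ a b : Fin (d + 1), a ≤ b → f (π.symm a) = f (π.symm b) →
        coordDiff (π.symm b) (π.symm a) w = 0 := by
      intro a b hab hfab
      refine AddSubmonoid.mem_bot.1 (coordDiff_mem ⊥ π hab fun l hl hl' => ?_)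
      rw [AddSubmonoid.mem_bot]
      refine h l ?_
      rintro ⟨i, -, hik, hi⟩
      have h₁ := (OrderedPartition.index_lt_iff hf hmono hik.le a).2
        (by rw [Fin.le_def, Fin.val_castSucc] at hl; omega)
      have h₂ := (OrderedPartition.index_lt_iff hf hmono hik.le b).not.2
        (by rw [Fin.le_def, Fin.val_succ] at hl'; omega)
      rw [hfab] at h₁
      exact h₂ h₁
    intro x y hxy
    rw [OrderedPartition.equiv_iff_index hf] at hxy
    obtain ⟨a, rfl⟩ := π.symm.surjective x
    obtain ⟨b, rfl⟩ := π.symm.surjective y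
    rcases le_total a b with hab | hab
    · rw [coordDiff_swap, key a b hab hxy, neg_zero]
    · exact key b a hab hxy.symm

-- Cones as sets of monotone gap functions, and their strict points.

namespace PartitionLabeledTree

variable {P Q : PartitionLabeledTree d} {π : Equiv.Perm (Fin (d + 1))}

/-- The values of the gaps at the type of `P`. -/
def treeGap (P : PartitionLabeledTree d) (π : Equiv.Perm (Fin (d + 1))) (w : W d) (i : ℕ) : ℝ :=
  gap π (P.part.typeAt (i + 1)) w

/-- The points `w` of `W_S` that give a monotone gap function, with respect to the relation `r`. -/
def MonoMem (r : ℝ → ℝ → Prop) (P : PartitionLabeledTree d) (π : Equiv.Perm (Fin (d + 1)))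
    (w : W d) : Prop :=
  w ∈ WS P.part ∧ P.tree.Mono r 0 (P.treeGap π w)

theorem exists_typeAt_eq (P : PartitionLabeledTree d) {i : ℕ} (hi : i + 1 < P.tree.numLeaves) :
    ∃ l : Fin d, l.val + 1 = P.part.typeAt (i + 1) := by
  rw [← P.length_eq] at hi
  have h₁ := OrderedPartition.typeAt_lt_typeAt (show 0 < i + 1 by omega) hi.le
  have h₂ := OrderedPartition.typeAt_lt_typeAt hi le_rfl
  rw [OrderedPartition.typeAt_length] at h₂
  exact ⟨⟨P.part.typeAt (i + 1) - 1, by omega⟩, by simp only; omega⟩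

theorem typeAt_inj (P : PartitionLabeledTree d) {i j : ℕ} (hi : i < P.tree.numLeaves)
    (hj : j < P.tree.numLeaves) (h : P.part.typeAt i = P.part.typeAt j) : i = j := by
  rw [← P.length_eq] at hi hj
  exact OrderedPartition.typeAt_inj hi.le hj.le h

theorem prec_iff (P : PartitionLabeledTree d) {i j : ℕ} (hi : i + 1 < P.tree.numLeaves)
    (hj : j + 1 < P.tree.numLeaves) :
    P.Prec (P.part.typeAt (i + 1)) (P.part.typeAt (j + 1)) ↔
      P.tree.gapPath j <+: P.tree.gapPath i := by
  rw [← PlaneTree.labeledVertex_succ, ← PlaneTree.labeledVertex_succ]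
  constructor
  · rintro ⟨a, b, ⟨-, ha⟩, ⟨-, hb⟩, hia, hjb, h⟩
    rw [P.typeAt_inj hi ha hia, P.typeAt_inj hj hb hjb]
    exact h
  · exact fun h => ⟨_, _, ⟨by omega, hi⟩, ⟨by omega, hj⟩, rfl, rfl, h⟩

/-- Among the labels whose vertices lie weakly below the given vertex, one with the longest address
is minimal. -/
theorem exists_minimal (P : PartitionLabeledTree d) {i : ℕ} (hi : i + 1 < P.tree.numLeaves) :
    ∃ j, j + 1 < P.tree.numLeaves ∧ P.tree.gapPath i <+: P.tree.gapPath j ∧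
      P.IsMinimalLabel (P.part.typeAt (j + 1)) := by
  obtain ⟨j, hj, hmax⟩ := Finset.exists_max_image
    ((Finset.range (P.tree.numLeaves - 1)).filter fun j => P.tree.gapPath i <+: P.tree.gapPath j)
    (fun j => (P.tree.gapPath j).length) ⟨i, by simp; omega⟩
  simp only [Finset.mem_filter, Finset.mem_range] at hj hmax
  refine ⟨j, by omega, hj.2, ⟨j + 1, by omega, by omega, rfl⟩, fun m hm => ?_⟩
  have hm' := hm
  obtain ⟨a, b, ⟨ha, ha'⟩, -, rfl, -, -⟩ := hm'
  obtain ⟨a, rfl⟩ := Nat.exists_eq_add_of_le' ha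
  rw [P.prec_iff ha' (by omega)] at hm
  rw [P.prec_iff (by omega) ha']
  have := hmax a ⟨by omega, hj.2.trans hm⟩
  rw [hm.eq_of_length_le this]

/-- The cone demands nonnegativity only at minimal labels; since every label dominates a minimal
one, it holds at all labels. -/
theorem mem_coneWith_iff {w : W d} :
    w ∈ P.coneWith π ↔ MonoMem (· ≤ ·) P π w := by
  refine and_congr_right fun hw => ?_
  rw [PlaneTree.mono_iff_gapPath P.branching]
  simp only [zero_add, treeGap]
  constructor
  · rintro ⟨h₁, h₂⟩
    have hle : ∀ i j, i + 1 < P.tree.numLeaves → j + 1 < P.tree.numLeaves →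
        P.tree.gapPath j <+: P.tree.gapPath i →
        gap π (P.part.typeAt (i + 1)) w ≤ gap π (P.part.typeAt (j + 1)) w := by
      intro i j hi hj hp
      rw [← P.prec_iff hi hj] at hp
      obtain ⟨k, hk⟩ := P.exists_typeAt_eq hi
      obtain ⟨l, hl⟩ := P.exists_typeAt_eq hj
      rw [← hk, ← hl] at hp ⊢
      rw [gap_succ, gap_succ]
      exact h₁ k l hp
    refine ⟨fun i hi => ?_, hle⟩
    obtain ⟨j, hj, hij, hmin⟩ := P.exists_minimal hi
    obtain ⟨l, hl⟩ := P.exists_typeAt_eq hj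
    refine le_trans ?_ (hle j i hj hi hij)
    rw [← hl] at hmin ⊢
    rw [gap_succ]
    exact h₂ l hmin
  · rintro ⟨h₁, h₂⟩
    constructor
    · intro i j hij
      have hij' := hij
      obtain ⟨a, b, ⟨ha, ha'⟩, ⟨hb, hb'⟩, hia, hjb, -⟩ := hij'
      obtain ⟨a, rfl⟩ := Nat.exists_eq_add_of_le' ha
      obtain ⟨b, rfl⟩ := Nat.exists_eq_add_of_le' hb
      rw [hia, hjb, P.prec_iff ha' hb'] at hij
      rw [← gap_succ, ← gap_succ, hia, hjb]
      exact h₂ a b ha' hb' hij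
    · rintro l ⟨⟨a, ha, ha', hl⟩, -⟩
      obtain ⟨a, rfl⟩ := Nat.exists_eq_add_of_le' ha
      rw [← gap_succ, hl]
      exact h₁ a ha'

theorem mem_coneWith_of_contract (hpart : P.part = Q.part) (htree : P.tree.ContractEdge Q.tree) :
    ∃ φ : W d →ₗ[ℝ] ℝ, (∀ w ∈ P.coneWith π, 0 ≤ φ w) ∧
      ∀ w, w ∈ Q.coneWith π ↔ w ∈ P.coneWith π ∧ φ w = 0 := by
  obtain ⟨i, j, -, -, h⟩ := htree.exists_mono_iff P.branching 0
  have htg : ∀ w, Q.treeGap π w = P.treeGap π w := fun w => by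
    funext k
    rw [treeGap, treeGap, hpart]
  refine ⟨gap π (P.part.typeAt (j + 1)) - gap π (P.part.typeAt (i + 1)), fun w hw => ?_,
    fun w => ?_⟩
  · rw [LinearMap.sub_apply, sub_nonneg]
    exact (h (P.treeGap π w)).1 ((mem_coneWith_iff).1 hw).2
  · rw [mem_coneWith_iff, mem_coneWith_iff, MonoMem, MonoMem, htg, ← hpart,
      (h _).2, LinearMap.sub_apply, sub_eq_zero, and_assoc, eq_comm]
    rfl

theorem refines_of_collapse (hπ : (OrderedPartition.ofPerm π).Refines P.part) {a m : ℕ}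
    (htree : P.tree.CollapseVertex a m Q.tree)
    (hpart : Q.part.blocks = P.part.blocks.take a ++
      ((P.part.blocks.drop a).take m).foldr (· ∪ ·) ∅ :: P.part.blocks.drop (a + m)) :
    (OrderedPartition.ofPerm π).Refines Q.part := by
  have := htree.two_le P.branching
  exact hπ.trans (OrderedPartition.refines_merge (P.length_eq ▸ htree.numLeaves_add.2) (by omega)
    hpart)

/-- Being constant on the merged block adds exactly the vanishing of the `m - 1` gaps inside it,
which is the side condition in `CollapseVertex.mono_iff`. -/
theorem mem_coneWith_of_collapse (hπ : (OrderedPartition.ofPerm π).Refines P.part) {a m : ℕ}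
    (htree : P.tree.CollapseVertex a m Q.tree)
    (hpart : Q.part.blocks = P.part.blocks.take a ++
      ((P.part.blocks.drop a).take m).foldr (· ∪ ·) ∅ :: P.part.blocks.drop (a + m)) (w : W d) :
    w ∈ Q.coneWith π ↔ w ∈ P.coneWith π ∧ P.treeGap π w a = 0 := by
  have hm := htree.two_le P.branching
  obtain ⟨hn, ham⟩ := htree.numLeaves_add
  have hP := P.length_eq
  have hQ := Q.length_eq
  have hlt : ∀ i ≤ a, Q.part.typeAt i = P.part.typeAt i := fun i hi =>
    OrderedPartition.typeAt_merge_of_le (by omega) hpart hi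
  have hgt : ∀ i, a < i → Q.part.typeAt i = P.part.typeAt (i + (m - 1)) := fun i hi =>
    OrderedPartition.typeAt_merge_of_gt (by omega) (by omega) hpart hi
  have hWS : w ∈ WS Q.part ↔ w ∈ WS P.part ∧
      ∀ i, a ≤ i → i + 1 < a + m → P.treeGap π w (0 + i) = 0 := by
    rw [mem_WS_iff hπ, mem_WS_iff (refines_of_collapse hπ htree hpart)]
    constructor
    · refine fun h => ⟨fun l hl => h l ?_, fun i hi hi' => ?_⟩
      · rintro ⟨i, hi, hi', hli⟩
        by_cases hia : i ≤ a
        · exact hl ⟨i, hi, by omega, by rw [hli, hlt i hia]⟩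
        · exact hl ⟨i + (m - 1), by omega, by omega, by rw [hli, hgt i (by omega)]⟩
      · obtain ⟨l, hl⟩ := P.exists_typeAt_eq (show i + 1 < P.tree.numLeaves by omega)
        rw [zero_add, treeGap, ← hl, gap_succ]
        refine h l ?_
        rintro ⟨j, hj, hj', hlj⟩
        rw [hl] at hlj
        by_cases hja : j ≤ a
        · rw [hlt j hja] at hlj
          have := P.typeAt_inj (by omega) (by omega) hlj
          omega
        · rw [hgt j (by omega)] at hlj
          have := P.typeAt_inj (by omega) (by omega) hlj
          omega
    · rintro ⟨h₁, h₂⟩ l hl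
      by_cases hex : ∃ i, 1 ≤ i ∧ i < P.part.blocks.length ∧ l.val + 1 = P.part.typeAt i
      · obtain ⟨i, hi, hi', hli⟩ := hex
        by_cases hia : i ≤ a
        · exact absurd ⟨i, hi, by omega, by rw [hli, hlt i hia]⟩ hl
        by_cases him : i < a + m
        · have := h₂ (i - 1) (by omega) (by omega)
          rwa [zero_add, treeGap, show i - 1 + 1 = i by omega, ← hli, gap_succ] at this
        · refine absurd ⟨i - (m - 1), by omega, by omega, ?_⟩ hl
          rw [hli, hgt _ (by omega)]
          congr 1
          omega
      · exact h₁ l hex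
  have htr := htree.mono_iff P.branching (o := 0) (g := P.treeGap π w) (g' := Q.treeGap π w)
    (fun i hi => by rw [zero_add, treeGap, treeGap, hlt _ (by omega)])
    (fun i hi => by
      rw [zero_add, treeGap, treeGap, hgt _ (by omega)]
      congr 3
      omega)
  rw [zero_add] at htr
  rw [mem_coneWith_iff, mem_coneWith_iff, MonoMem, MonoMem,
    hWS, and_assoc, and_assoc, ← htr]
  tauto

theorem Step.refines (h : Step P Q) (hπ : (OrderedPartition.ofPerm π).Refines P.part) :
    (OrderedPartition.ofPerm π).Refines Q.part := by
  cases h with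
  | contract hpart _ => exact hpart ▸ hπ
  | collapse a m htree hpart => exact refines_of_collapse hπ htree hpart

theorem Step.exists_coneWith_eq (h : Step P Q) (hπ : (OrderedPartition.ofPerm π).Refines P.part) :
    ∃ φ : W d →ₗ[ℝ] ℝ, (∀ w ∈ P.coneWith π, 0 ≤ φ w) ∧
      ∀ w, w ∈ Q.coneWith π ↔ w ∈ P.coneWith π ∧ φ w = 0 := by
  cases h with
  | contract hpart htree => exact mem_coneWith_of_contract hpart htree
  | collapse a m htree hpart =>
    refine ⟨gap π (P.part.typeAt (a + 1)), fun w hw => ?_,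
      fun w => mem_coneWith_of_collapse hπ htree hpart w⟩
    have := htree.two_le P.branching
    have := htree.numLeaves_add
    exact ((mem_coneWith_iff).1 hw).2.rel_zero (Nat.zero_le _) (by omega)

/-- Failure of strictness puts `w` in the cone of a covering tree, which has fewer internal
vertices, so the descent ends. -/
theorem exists_le_strict {w : W d} (hπ : (OrderedPartition.ofPerm π).Refines P.part)
    (hw : w ∈ P.coneWith π) : ∃ Q : PartitionLabeledTree d, P ≤ Q ∧
      (OrderedPartition.ofPerm π).Refines Q.part ∧ MonoMem (· < ·) Q π w := by
  induction hN : P.tree.numInternal using Nat.strong_induction_on generalizing P with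
  | _ N ih =>
    have step : ∀ Q, Step P Q → w ∈ Q.coneWith π → ∃ Q : PartitionLabeledTree d, P ≤ Q ∧
        (OrderedPartition.ofPerm π).Refines Q.part ∧ MonoMem (· < ·) Q π w := by
      intro Q hQ hwQ
      obtain ⟨R, hQR, h⟩ := ih _ (hN ▸ hQ.numInternal_lt) (hQ.refines hπ) hwQ rfl
      exact ⟨R, Relation.ReflTransGen.head hQ hQR, h⟩
    obtain ⟨hWS, hM⟩ := (mem_coneWith_iff).1 hw
    rcases hM.strict_or_exists P.branching with h | ⟨T', hT', h⟩ | ⟨a, m, T', hT', h⟩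
    · exact ⟨P, le_refl P, hπ, hWS, h⟩
    · let Q : PartitionLabeledTree d := ⟨P.part, T', hT'.strictlyBranching P.branching, by
        rw [P.length_eq, hT'.numLeaves_eq]⟩
      exact step Q (.contract rfl hT') ((mem_coneWith_iff (P := Q)).2 ⟨hWS, h⟩)
    · have hm := hT'.two_le P.branching
      have hn := hT'.numLeaves_add
      have hP := P.length_eq
      obtain ⟨S', hS'⟩ := P.part.exists_merge (a := a) (m := m) (by omega) (by omega)
      let Q : PartitionLabeledTree d := ⟨S', T', hT'.strictlyBranching P.branching, by
        rw [hS']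
        simp
        omega⟩
      rw [zero_add] at h
      exact step Q (.collapse a m hT' hS') ((mem_coneWith_of_collapse (Q := Q) hπ hT' hS' w).2 ⟨hw, h⟩)

/-- At a strict point the gaps are positive at the type and zero elsewhere, so comparing coordinates
recovers the preorder of the partition. -/
theorem MonoMem.le_iff {w : W d} (hπ : (OrderedPartition.ofPerm π).Refines P.part)
    (hw : MonoMem (· < ·) P π w) (x y : Fin (d + 1)) :
    P.part.Le x y ↔ coordDiff x y w ≤ 0 := by
  obtain ⟨hWS, hM⟩ := hw
  have hWS' := (mem_WS_iff hπ).1 hWS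
  obtain ⟨f, hf⟩ := P.part.exists_index
  have hmono := (P.part.refines_ofPerm_iff hf π).1 hπ
  have hpos : ∀ l : Fin d,
      (∃ i, 1 ≤ i ∧ i < P.part.blocks.length ∧ l.val + 1 = P.part.typeAt i) → 0 < D π l w := by
    rintro l ⟨i, hi, hi', hl⟩
    obtain ⟨i, rfl⟩ := Nat.exists_eq_add_of_le' hi
    rw [← gap_succ, hl]
    rw [P.length_eq] at hi'
    exact hM.rel_zero (i := i) (Nat.zero_le _) (by omega)
  have hnonneg : ∀ l : Fin d, 0 ≤ D π l w := fun l => by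
    by_cases h : ∃ i, 1 ≤ i ∧ i < P.part.blocks.length ∧ l.val + 1 = P.part.typeAt i
    · exact (hpos l h).le
    · exact (hWS' l h).ge
  have hle : ∀ a b : Fin (d + 1), a ≤ b → 0 ≤ coordDiff (π.symm b) (π.symm a) w := fun a b hab =>
    AddSubmonoid.mem_nonneg.1 (coordDiff_mem _ π hab fun l _ _ =>
      AddSubmonoid.mem_nonneg.2 (hnonneg l))
  have hlt : ∀ a b : Fin (d + 1), f (π.symm a) < f (π.symm b) →
      0 < coordDiff (π.symm b) (π.symm a) w := by
    intro a b hab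
    have h₁ := (OrderedPartition.index_lt_iff hf hmono (f (π.symm b)).2.le a).1 hab
    have h₂ := (OrderedPartition.index_lt_iff hf hmono (f (π.symm b)).2.le b).not.1 (lt_irrefl _)
    have h₃ : (f (π.symm a)).val < (f (π.symm b)).val := hab
    obtain ⟨i, hi⟩ := Nat.exists_eq_add_of_lt h₃
    obtain ⟨l, hl⟩ := P.exists_typeAt_eq (i := (f (π.symm b)).val - 1) (by
      have := (f (π.symm b)).2
      have := P.length_eq
      omega)
    rw [show (f (π.symm b)).val - 1 + 1 = (f (π.symm b)).val by omega] at hl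
    rw [← coordDiff_add _ (π.symm l.succ), ← coordDiff_add _ (π.symm l.castSucc) (π.symm a)]
    refine add_pos_of_nonneg_of_pos (hle _ _ ?_) (add_pos_of_pos_of_nonneg
      (hpos l ⟨_, by omega, (f (π.symm b)).2, hl⟩) (hle _ _ ?_))
    · rw [Fin.le_def, Fin.val_succ]
      omega
    · rw [Fin.le_def, Fin.val_castSucc]
      omega
  rw [OrderedPartition.le_iff_index hf]
  rcases lt_trichotomy (f x) (f y) with h | h | h
  · have := hlt (π x) (π y) (by simpa using h)
    rw [Equiv.symm_apply_apply, Equiv.symm_apply_apply, coordDiff_swap] at this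
    exact iff_of_true h.le (by linarith)
  · exact iff_of_true h.le (hWS x y ((OrderedPartition.equiv_iff_index hf).2 h)).le
  · have := hlt (π y) (π x) (by simpa using h)
    rw [Equiv.symm_apply_apply, Equiv.symm_apply_apply] at this
    exact iff_of_false h.not_ge this.not_ge

/-- The order of the coordinates gives the partition; the gaps are then independent of the
permutation, and they give the tree. -/
theorem MonoMem.eq {w : W d} {π' : Equiv.Perm (Fin (d + 1))}
    (hπ : (OrderedPartition.ofPerm π).Refines P.part)
    (hπ' : (OrderedPartition.ofPerm π').Refines Q.part)
    (hP : MonoMem (· < ·) P π w) (hQ : MonoMem (· < ·) Q π' w) : P = Q := by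
  have hpart : P.part = Q.part :=
    OrderedPartition.eq_of_le_iff fun x y => (hP.le_iff hπ x y).trans (hQ.le_iff hπ' x y).symm
  have htg : Q.treeGap π' w = P.treeGap π w := by
    funext k
    rw [treeGap, treeGap, hpart, gap, gap]
    split_ifs with h
    · exact D_eq_of_refines hπ' (hpart ▸ hπ) hQ.1 _
    · rfl
  have htree : P.tree = Q.tree := hP.2.eq_of_strict P.branching Q.branching
    (by rw [← P.length_eq, ← Q.length_eq, hpart]) (htg ▸ hQ.2)
  cases P
  cases Q
  simp_all

theorem exists_monoMem_strict (hπ : (OrderedPartition.ofPerm π).Refines P.part) :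
    ∃ w, MonoMem (· < ·) P π w := by
  obtain ⟨g, hg⟩ := P.tree.exists_strict
  classical
  -- Put the values of a strict gap function at the type and 0 elsewhere; the chosen index is unique
  -- because the type is strictly increasing.
  obtain ⟨w, hw⟩ := exists_gap_eq (fun p =>
    if h : ∃ i, i + 1 < P.tree.numLeaves ∧ p = P.part.typeAt (i + 1) then g h.choose else 0) π
  refine ⟨w, (mem_WS_iff hπ).2 fun l hl => ?_, hg.congr fun i hi => ?_⟩
  · rw [hw, dif_neg]
    rintro ⟨i, hi, hli⟩
    exact hl ⟨i + 1, by omega, by rwa [P.length_eq], hli⟩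
  · obtain ⟨l, hl⟩ := P.exists_typeAt_eq hi
    have hex : ∃ j, j + 1 < P.tree.numLeaves ∧ l.val + 1 = P.part.typeAt (j + 1) := ⟨i, hi, hl⟩
    rw [zero_add, treeGap, ← hl, gap_succ, hw, dif_pos hex]
    congr 1
    have h := hex.choose_spec
    have := P.typeAt_inj hi h.1 (hl ▸ h.2)
    omega

end PartitionLabeledTree
end PermutoAssoc

namespace PermutoAssoc

variable {d : ℕ}

/-! ### Faces -/

/-- `F` is an extreme subset of `C`, in the form that suits convex cones. -/
def IsExtremeSubcone {V : Type*} [AddCommGroup V] (C F : Set V) : Prop :=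
  F ⊆ C ∧ ∀ x ∈ C, ∀ y ∈ C, x + y ∈ F → x ∈ F

/-- Extremality passes along a chain of covering steps at once, without combining the functionals of
the steps. -/
theorem IsExtremeSubcone.trans {V : Type*} [AddCommGroup V] {C F G : Set V}
    (h : IsExtremeSubcone C F) (h' : IsExtremeSubcone F G) : IsExtremeSubcone C G := by
  refine ⟨h'.1.trans h.1, fun x hx y hy hxy => ?_⟩
  have hF := h'.1 hxy
  exact h'.2 x (h.2 x hx y hy hF) y (h.2 y hy x hx (by rwa [add_comm])) hxy

/-- An extreme subcone of a polyhedral cone is an exposed face. -/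
theorem isFace_of_isExtremeSubcone {A : Set (W d →ₗ[ℝ] ℝ)} (hA : A.Finite) {C F : Set (W d)}
    (hC : ∀ w, w ∈ C ↔ ∀ a ∈ A, 0 ≤ a w) (h0 : (0 : W d) ∈ F)
    (hadd : ∀ x ∈ F, ∀ y ∈ F, x + y ∈ F) (hsmul : ∀ t : ℝ, 0 ≤ t → ∀ x ∈ F, t • x ∈ F)
    (h : IsExtremeSubcone C F) : IsFace C F := by
  classical
  -- `Z` collects the inequalities that are tight on all of `F`, and `N` the others.
  let Z := hA.toFinset.filter fun a => ∀ x ∈ F, a x = 0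
  let N := hA.toFinset.filter fun a => ¬ ∀ x ∈ F, a x = 0
  have hmem : ∀ a, a ∈ A ↔ a ∈ Z ∨ a ∈ N := by
    intro a
    simp only [Z, N, Finset.mem_filter, Set.Finite.mem_toFinset]
    tauto
  have hnonneg : ∀ a ∈ A, ∀ x ∈ F, 0 ≤ a x := fun a ha x hx => (hC x).1 (h.1 hx) a ha
  have hZ : ∀ a ∈ Z, ∀ x ∈ F, a x = 0 := fun a ha => (Finset.mem_filter.1 ha).2
  -- A relative interior point of `F`: the sum of one witness for each inequality in `N`.
  obtain ⟨w, hwF, hw⟩ : ∃ w ∈ F, ∀ a ∈ N, 0 < a w := by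
    have : ∀ M ⊆ N, ∃ w ∈ F, ∀ a ∈ M, 0 < a w := by
      intro M
      induction M using Finset.induction_on with
      | empty => exact fun _ => ⟨0, h0, by simp⟩
      | insert b M _ ih =>
        intro hM
        obtain ⟨w, hwF, hw⟩ := ih fun a ha => hM (Finset.mem_insert_of_mem ha)
        have hb := hM (Finset.mem_insert_self b M)
        obtain ⟨x, hx, hbx⟩ : ∃ x ∈ F, b x ≠ 0 := by
          have := (Finset.mem_filter.1 hb).2
          push Not at this
          exact this
        have hAN : ∀ a ∈ N, ∀ x ∈ F, 0 ≤ a x := fun a ha => hnonneg a ((hmem a).2 (Or.inr ha))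
        refine ⟨x + w, hadd _ hx _ hwF, fun a ha => ?_⟩
        rw [map_add]
        rcases Finset.mem_insert.1 ha with rfl | ha'
        · exact add_pos_of_pos_of_nonneg (lt_of_le_of_ne (hAN a hb x hx) hbx.symm) (hAN a hb w hwF)
        · exact add_pos_of_nonneg_of_pos (hAN a (hM ha) x hx) (hw a ha')
    exact this N Finset.Subset.rfl
  refine Or.inr ⟨-∑ a ∈ Z, a, ?_⟩
  ext x
  simp only [LinearMap.neg_apply, LinearMap.sum_apply, Set.mem_ofPred_eq, neg_le_neg_iff]
  constructor
  · intro hx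
    refine ⟨h.1 hx, fun y hy => ?_⟩
    rw [Finset.sum_eq_zero fun a ha => hZ a ha x hx]
    exact Finset.sum_nonneg fun a ha => (hC y).1 hy a ((hmem a).2 (Or.inl ha))
  · rintro ⟨hx, hmax⟩
    have hx0 : ∀ a ∈ Z, 0 ≤ a x := fun a ha => (hC x).1 hx a ((hmem a).2 (Or.inl ha))
    have hsum := hmax 0 (h.1 h0)
    simp only [map_zero, Finset.sum_const_zero] at hsum
    have hxZ := (Finset.sum_eq_zero_iff_of_nonneg hx0).1 (le_antisymm hsum (Finset.sum_nonneg hx0))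
    -- With `t` this large, `t • w - x` stays in `C`. It adds up with `x` to `t • w`, which is in
    -- `F`, so extremality puts `x` in `F`.
    let t := ∑ a ∈ N, |a x| / a w
    have hterm : ∀ a ∈ N, 0 ≤ |a x| / a w := fun a ha => div_nonneg (abs_nonneg _) (hw a ha).le
    have ht : 0 ≤ t := Finset.sum_nonneg hterm
    refine h.2 x hx (t • w - x) ((hC _).2 fun a ha => ?_) ?_
    · rw [map_sub, map_smul, smul_eq_mul]
      rcases (hmem a).1 ha with ha | ha
      · rw [hZ a ha w hwF, hxZ a ha]
        simp
      · have h₁ := Finset.single_le_sum hterm ha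
        have h₂ := (div_le_iff₀ (hw a ha)).1 h₁
        have h₃ := le_abs_self (a x)
        simp only [t]
        linarith
    · rw [add_sub_cancel]
      exact hsmul t ht w hwF

-- The Kapranov order and faces of the cones.

namespace PartitionLabeledTree

variable {P Q : PartitionLabeledTree d}

theorem exists_finite_inequalities (P : PartitionLabeledTree d) (π : Equiv.Perm (Fin (d + 1))) :
    ∃ A : Set (W d →ₗ[ℝ] ℝ), A.Finite ∧ ∀ w, w ∈ P.coneWith π ↔ ∀ a ∈ A, 0 ≤ a w := by
  -- Each equation within a block is a pair of opposite inequalities, as the relation is symmetric.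
  refine ⟨{a | ∃ x y, P.part.Equiv x y ∧ a = coordDiff x y} ∪
    {a | ∃ i j : Fin d, P.Prec (i + 1) (j + 1) ∧ a = D π j - D π i} ∪
    {a | ∃ l : Fin d, P.IsMinimalLabel (l + 1) ∧ a = D π l}, ?_, fun w => ?_⟩
  · refine ((Set.Finite.subset (Set.finite_range fun p : Fin (d + 1) × Fin (d + 1) =>
      coordDiff p.1 p.2) ?_).union (Set.Finite.subset (Set.finite_range fun p : Fin d × Fin d =>
      D π p.2 - D π p.1) ?_)).union (Set.Finite.subset (Set.finite_range fun l => D π l) ?_)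
    · rintro _ ⟨x, y, -, rfl⟩
      exact ⟨(x, y), rfl⟩
    · rintro _ ⟨x, y, -, rfl⟩
      exact ⟨(x, y), rfl⟩
    · rintro _ ⟨l, -, rfl⟩
      exact ⟨l, rfl⟩
  · constructor
    · rintro ⟨h₁, h₂, h₃⟩ _ ((⟨x, y, h, rfl⟩ | ⟨i, j, h, rfl⟩) | ⟨l, h, rfl⟩)
      · exact (h₁ x y h).ge
      · exact sub_nonneg.2 (h₂ i j h)
      · exact h₃ l h
    · intro h
      refine ⟨fun x y hxy => le_antisymm ?_ ?_, fun i j hij => ?_, fun l hl => ?_⟩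
      · have := h _ (Or.inl (Or.inl ⟨y, x, hxy.symm, rfl⟩))
        rw [coordDiff_swap] at this
        linarith
      · exact h _ (Or.inl (Or.inl ⟨x, y, hxy, rfl⟩))
      · exact sub_nonneg.1 (h _ (Or.inl (Or.inr ⟨i, j, hij, rfl⟩)))
      · exact h _ (Or.inr ⟨l, hl, rfl⟩)

/-- In each step the functional is nonnegative on the larger cone, so if it vanishes on a sum it
vanishes on both summands. Refinement is carried along so that one `π` serves the whole chain. -/
theorem isExtremeSubcone_of_le (h : P ≤ Q) {π : Equiv.Perm (Fin (d + 1))}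
    (hπ : (OrderedPartition.ofPerm π).Refines P.part) :
    (OrderedPartition.ofPerm π).Refines Q.part ∧
      IsExtremeSubcone (P.coneWith π) (Q.coneWith π) := by
  change Relation.ReflTransGen Step P Q at h
  induction h with
  | refl => exact ⟨hπ, subset_rfl, fun x hx _ _ _ => hx⟩
  | tail _ hs ih =>
    obtain ⟨hR, hext⟩ := ih
    refine ⟨hs.refines hR, hext.trans ?_⟩
    obtain ⟨φ, hφ, h⟩ := hs.exists_coneWith_eq hR
    refine ⟨fun w hw => ((h w).1 hw).1, fun x hx y hy hxy => (h x).2 ⟨hx, ?_⟩⟩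
    have h₁ := ((h _).1 hxy).2
    rw [map_add] at h₁
    linarith [hφ x hx, hφ y hy]

theorem isFace_of_le (h : P ≤ Q) : IsFace P.cone Q.cone := by
  obtain ⟨π, hπ⟩ := P.part.exists_refines
  obtain ⟨hπ', hext⟩ := isExtremeSubcone_of_le h hπ
  rw [P.cone_eq hπ, Q.cone_eq hπ']
  obtain ⟨A, hA, hC⟩ := P.exists_finite_inequalities π
  obtain ⟨B, -, hQ⟩ := Q.exists_finite_inequalities π
  refine isFace_of_isExtremeSubcone hA hC ?_ ?_ ?_ hext
  · simp [hQ]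
  · intro x hx y hy
    rw [hQ] at hx hy ⊢
    intro b hb
    rw [map_add]
    exact add_nonneg (hx b hb) (hy b hb)
  · intro t ht x hx
    rw [hQ] at hx ⊢
    intro b hb
    rw [map_smul]
    exact mul_nonneg ht (hx b hb)

theorem exists_strict_mem_cone (Q : PartitionLabeledTree d) : ∃ π w,
    (OrderedPartition.ofPerm π).Refines Q.part ∧ MonoMem (· < ·) Q π w ∧ w ∈ Q.cone := by
  obtain ⟨π, hπ⟩ := Q.part.exists_refines
  obtain ⟨w, hw⟩ := exists_monoMem_strict hπ
  refine ⟨π, w, hπ, hw, ?_⟩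
  rw [Q.cone_eq hπ, mem_coneWith_iff]
  exact ⟨hw.1, hw.2.of_strict⟩

/-- A strict point of `Q` lies in the cone of `P`, hence is strict for some `R ≥ P`; strict points
determine the labeled tree, so `R = Q`. -/
theorem le_of_cone_subset (h : Q.cone ⊆ P.cone) : P ≤ Q := by
  obtain ⟨π', w, hπ', hw, hwQ⟩ := Q.exists_strict_mem_cone
  obtain ⟨π, hπ⟩ := P.part.exists_refines
  have hwP := h hwQ
  rw [P.cone_eq hπ] at hwP
  obtain ⟨R, hPR, hR, hRw⟩ := exists_le_strict hπ hwP
  rwa [hRw.eq hR hπ' hw] at hPR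

theorem le_iff_isFace : P ≤ Q ↔ IsFace P.cone Q.cone := by
  refine ⟨isFace_of_le, ?_⟩
  -- The empty face is excluded because every cone contains a strict point.
  rintro (h | ⟨l, h⟩)
  · obtain ⟨-, w, -, -, hw⟩ := Q.exists_strict_mem_cone
    rw [h] at hw
    exact hw.elim
  · refine le_of_cone_subset fun w hw => ?_
    rw [h] at hw
    exact hw.1

theorem cone_injective : Function.Injective (cone : PartitionLabeledTree d → Set (W d)) :=
  fun _ _ h => le_antisymm (le_of_cone_subset h.ge) (le_of_cone_subset h.le)

end PartitionLabeledTree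
end PermutoAssoc

theorem proposition5p6 (d : ℕ) :
    Set.BijOn (fun P : PermutoAssoc.PartitionLabeledTree d => P.cone) Set.univ
      (PermutoAssoc.Xi d) ∧
    ∀ P₁ P₂ : PermutoAssoc.PartitionLabeledTree d,
      (P₁ : PermutoAssoc.KapranovPoset d) ≤ (P₂ : PermutoAssoc.KapranovPoset d) ↔
        PermutoAssoc.IsFace P₁.cone P₂.cone := by
  refine ⟨⟨fun P _ => ⟨P, rfl⟩, PermutoAssoc.PartitionLabeledTree.cone_injective.injOn, ?_⟩,
    fun P₁ P₂ => ?_⟩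
  · rintro _ ⟨P, rfl⟩
    exact ⟨P, trivial, rfl⟩
  · rw [WithBot.coe_le_coe, PermutoAssoc.PartitionLabeledTree.le_iff_isFace]
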